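/- Let $H$ be the discrete Schrödinger operator $(H\psi)(n)=\psi(n-1)+\psi(n+1)+V(n)\psi(n)$ with a real potential $V$, acting either in $\ell^2(\mathbb Z)$ or, with the Dirichlet condition $\psi(0)=0$, in $\ell^2(\mathbb N)$, $\mathbb N=\{1,2,3,\dots\}$, on its natural domain $\{\psi\in\ell^2 : H\psi\in\ell^2\}$, on which it is self-adjoint. For $z\in\mathbb C$ put $A(n,z)=\begin{pmatrix} z-V(n)&-1\\1&0\end{pmatrix}$ and let $T(n,m;z)$ be the transfer matrix: $T(n,m;z)=A(n,z)A(n-1,z)\cdots A(m+1,z)$ if $n>m$, $T(n,n;z)=I$, and $T(n,m;z)=T(m,n;z)^{-1}$ if $n<m$. Let $\psi(t)=e^{-itH}\delta_1$, $\psi(t,n)=\langle\psi(t),\delta_n\rangle$, and for $T>0$, $p>0$ put $$a(n,T)=\frac1T\int_0^\infty e^{-2t/T}|\psi(t,n)|^2\,dt,\qquad \langle|X|^p\rangle(T)=\sum_n|n|^p a(n,T),\qquad \beta^-(p)=\liminf_{T\to+\infty}\frac{\log\langle|X|^p\rangle(T)}{\log T}.$$ Suppose that for some $E_0\in\mathbb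 R$, $\alpha\ge 0$ and some constant $C=C(E_0)$, $$\|T(n,m;E_0)\|\le C\,(|n|+|m|)^\alpha$$ for all $n,m\in\mathbb Z$ with $(n,m)\neq(0,0)$ (respectively, for all $n,m\ge1$ in the half-line case). Then for every $p>0$, $$\beta^-(p)\ \ge\ \frac{p-1-4\alpha}{1+\alpha}.$$ -/

import Mathlib

open Filter Topology

namespace OneEnergy

/-- `ψ` is the (strong) solution of the Schrödinger equation `i ∂ₜ ψ = A ψ`, `ψ(0) = ψ₀`: the curve
stays in the domain of the unbounded operator `A` and is differentiable in norm at every time.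
For self-adjoint `A` and `ψ₀` in its domain this is exactly `ψ(t) = exp (-i t A) ψ₀`. -/
structure IsSchrodingerSolution {E : Type*} [NormedAddCommGroup E] [NormedSpace ℂ E]
    (A : E →ₗ.[ℂ] E) (ψ₀ : E) (ψ : ℝ → E) : Prop where
  init : ψ 0 = ψ₀
  mem_domain : ∀ t, ψ t ∈ A.domain
  hasDerivAt : ∀ (t : ℝ) (h : ψ t ∈ A.domain), HasDerivAt ψ (-(Complex.I • A ⟨ψ t, h⟩)) t

theorem norm_exp_sub_le (y : ℝ) :
    ‖Complex.exp (Complex.I * y) - 1 - Complex.I * y‖ ≤ 2 * y ^ 2 := by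
  have hn : ‖Complex.I * (y : ℂ)‖ = |y| := by simp
  rcases le_total |y| 1 with h | h
  · have := Complex.norm_exp_sub_one_sub_id_le (x := Complex.I * y) (by rw [hn]; exact h)
    rw [hn, sq_abs] at this
    nlinarith [sq_nonneg y]
  · have h1 := Real.norm_exp_I_mul_ofReal_sub_one_le (x := y)
    have h2 := norm_sub_le (Complex.exp (Complex.I * y) - 1) (Complex.I * y)
    rw [hn] at h2
    rw [Real.norm_eq_abs] at h1
    nlinarith [sq_abs y]

/-- The function `exp (-i t x)` with `x = 1 / w - 3 i`, used in the functional calculus of the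
resolvent `w = (x + 3 i)⁻¹`. -/
noncomputable def phase (t : ℝ) (w : ℂ) : ℂ := Complex.exp (-(Complex.I * t) * (w⁻¹ - 3 * Complex.I))

theorem exists_solution_of_resolvent {E : Type*} [NormedAddCommGroup E] [InnerProductSpace ℂ E]
    [CompleteSpace E] (A : E →ₗ.[ℂ] E) (R : E →L[ℂ] E) (hn : star R * R = R * star R)
    (hres : star R - R = (6 * Complex.I) • (R * star R))
    (hdom : ∀ v, R v ∈ A.domain)
    (hA : ∀ v (h : R v ∈ A.domain), A ⟨R v, h⟩ = v - (3 * Complex.I) • R v) (v : E) :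
    ∃ ψ, IsSchrodingerSolution A (R (R v)) ψ := by
  have hN : IsStarNormal R := ⟨hn⟩
  have hspec : ∀ w ∈ spectrum ℂ R, w ≠ 0 → ∃ x : ℝ, w⁻¹ - 3 * Complex.I = x := by
    have h1 : cfc (fun w : ℂ => star w - w) R
        = cfc (fun w : ℂ => (6 * Complex.I) * (w * star w)) R := by
      rw [cfc_sub (fun w : ℂ => star w) (fun w => w) R, cfc_star_id (R := ℂ) R, cfc_id' ℂ R,
        cfc_const_mul (6 * Complex.I) (fun w : ℂ => w * star w) R,
        cfc_mul (fun w : ℂ => w) (fun w => star w) R, cfc_star_id (R := ℂ) R, cfc_id' ℂ R, hres]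
    intro w hw hw0
    have h2 := (eqOn_of_cfc_eq_cfc (R := ℂ) h1 (by fun_prop) (by fun_prop)) hw
    beta_reduce at h2
    refine ⟨(w⁻¹ - 3 * Complex.I).re, ?_⟩
    have hs0 : star w ≠ 0 := star_ne_zero.mpr hw0
    have h3 : w⁻¹ - (star w)⁻¹ = 6 * Complex.I := by
      field_simp
      linear_combination h2
    apply Complex.ext
    · simp
    · have h4 := congrArg Complex.im h3
      have h5 : (star w)⁻¹ = star (w⁻¹) := (star_inv₀ w).symm
      rw [h5] at h4
      simp only [Complex.sub_im, Complex.star_def, Complex.conj_im, Complex.mul_im] at h4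
      norm_num at h4
      simp only [Complex.sub_im, Complex.mul_im, Complex.ofReal_im]
      norm_num
      linarith
  have hphase : ∀ t, ∀ w ∈ spectrum ℂ R, w ≠ 0 → ‖phase t w‖ = 1 := by
    intro t w hw hw0
    obtain ⟨x, hx⟩ := hspec w hw hw0
    rw [phase, hx]
    have : -(Complex.I * (t : ℂ)) * x = ((-(t * x) : ℝ) : ℂ) * Complex.I := by push_cast; ring
    rw [this, Complex.norm_exp_ofReal_mul_I]
  have hc1 : ∀ t, ContinuousOn (fun w : ℂ => w * phase t w) (spectrum ℂ R) := by
    intro t w hw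
    by_cases hw0 : w = 0
    · subst hw0
      have : Tendsto (fun w : ℂ => w * phase t w) (𝓝[spectrum ℂ R] 0) (𝓝 0) := by
        rw [tendsto_zero_iff_norm_tendsto_zero]
        have h0 : Tendsto (fun w : ℂ => ‖w‖) (𝓝[spectrum ℂ R] 0) (𝓝 0) := by
          have : Tendsto (fun w : ℂ => ‖w‖) (𝓝 0) (𝓝 ‖(0 : ℂ)‖) := continuous_norm.tendsto 0
          rw [norm_zero] at this
          exact this.mono_left nhdsWithin_le_nhds
        refine squeeze_zero' (Eventually.of_forall fun _ => norm_nonneg _) ?_ h0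
        filter_upwards [self_mem_nhdsWithin] with w hw
        by_cases h : w = 0
        · simp [h]
        · rw [norm_mul, hphase t w hw h, mul_one]
      simpa [ContinuousWithinAt] using this
    · have : ContinuousAt (fun w : ℂ => w * phase t w) w := by
        unfold phase
        fun_prop (disch := assumption)
      exact this.continuousWithinAt
  have hc2 : ∀ t, ContinuousOn (fun w : ℂ => w * (w * phase t w)) (spectrum ℂ R) := fun t =>
    continuousOn_id.mul (hc1 t)
  let G : ℝ → E →L[ℂ] E := fun t => cfc (fun w : ℂ => w * phase t w) R
  let W : ℝ → E →L[ℂ] E := fun t => cfc (fun w : ℂ => w * (w * phase t w)) R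
  have hWG : ∀ t, W t = R * G t := by
    intro t
    simp only [W, G]
    rw [cfc_mul (fun w : ℂ => w) (fun w => w * phase t w) R (by fun_prop) (hc1 t), cfc_id' ℂ R]
  have hder : ∀ t, HasDerivAt W (-(Complex.I • (G t - (3 * Complex.I) • W t))) t := by
    intro t
    have hD : (-(Complex.I • (G t - (3 * Complex.I) • W t)) : E →L[ℂ] E)
        = cfc (fun w : ℂ => -(Complex.I * (w * phase t w - 3 * Complex.I * (w * (w * phase t w))))) R := by
      rw [cfc_neg _ R, cfc_const_mul Complex.I _ R (by
          exact (hc1 t).sub (continuousOn_const.mul (hc2 t))),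
        cfc_sub (fun w : ℂ => w * phase t w) (fun w => 3 * Complex.I * (w * (w * phase t w))) R
          (hc1 t) (continuousOn_const.mul (hc2 t)),
        cfc_const_mul (3 * Complex.I) _ R (hc2 t)]
    rw [hasDerivAt_iff_isLittleO_nhds_zero]
    have hb : ∀ h : ℝ, ‖W (t + h) - W t - h • (-(Complex.I • (G t - (3 * Complex.I) • W t)))‖
        ≤ 2 * (1 + 3 * ‖R‖) ^ 2 * ‖h ^ 2‖ := by
      intro h
      rw [hD]
      have hcD : ContinuousOn (fun w : ℂ => -(Complex.I * (w * phase t w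
          - 3 * Complex.I * (w * (w * phase t w))))) (spectrum ℂ R) :=
        (continuousOn_const.mul ((hc1 t).sub (continuousOn_const.mul (hc2 t)))).neg
      have : (h • cfc (fun w : ℂ => -(Complex.I * (w * phase t w
          - 3 * Complex.I * (w * (w * phase t w))))) R : E →L[ℂ] E)
          = cfc (fun w : ℂ => (h : ℂ) * -(Complex.I * (w * phase t w
          - 3 * Complex.I * (w * (w * phase t w))))) R := by
        rw [cfc_const_mul (h : ℂ) _ R hcD]
        ext v; simp
      rw [this]
      simp only [W]
      rw [← cfc_sub _ _ R (hc2 _) (hc2 _), ← cfc_sub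
        (fun w : ℂ => w * (w * phase (t + h) w) - w * (w * phase t w))
        (fun w : ℂ => (h : ℂ) * -(Complex.I * (w * phase t w
          - 3 * Complex.I * (w * (w * phase t w))))) R ((hc2 _).sub (hc2 _))
        (continuousOn_const.mul hcD)]
      apply norm_cfc_le (by positivity)
      intro w hw
      have hwR : ‖w‖ ≤ ‖R‖ := by
        have h1 := spectrum.norm_le_norm_mul_of_mem hw
        have h2 : ‖(1 : E →L[ℂ] E)‖ ≤ 1 := ContinuousLinearMap.norm_id_le
        nlinarith [norm_nonneg R]
      by_cases hw0 : w = 0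
      · simp [hw0]; positivity
      obtain ⟨x, hx⟩ := hspec w hw hw0
      have hadd : phase (t + h) w = phase t w * Complex.exp (Complex.I * ((-(h * x) : ℝ) : ℂ)) := by
        rw [phase, phase, hx, ← Complex.exp_add]; congr 1; push_cast; ring
      have hwx : w * x = 1 - 3 * Complex.I * w := by
        rw [← hx]; field_simp
      have key : w * (w * phase (t + h) w) - w * (w * phase t w) - (h : ℂ) * -(Complex.I * (w * phase t w
          - 3 * Complex.I * (w * (w * phase t w))))
          = w ^ 2 * phase t w * (Complex.exp (Complex.I * ((-(h * x) : ℝ) : ℂ)) - 1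
            - Complex.I * ((-(h * x) : ℝ) : ℂ)) := by
        rw [hadd]; push_cast
        linear_combination (-(h : ℂ) * Complex.I * w * phase t w) * hwx
      rw [key, norm_mul, norm_mul, hphase t w hw hw0, norm_pow, mul_one]
      have h1 := norm_exp_sub_le (-(h * x))
      have h2 : ‖w‖ * |x| ≤ 1 + 3 * ‖R‖ := by
        calc ‖w‖ * |x| = ‖w * x‖ := by simp
          _ = ‖1 - 3 * Complex.I * w‖ := by rw [hwx]
          _ ≤ ‖(1 : ℂ)‖ + ‖3 * Complex.I * w‖ := norm_sub_le _ _
          _ ≤ 1 + 3 * ‖R‖ := by simp; linarith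
      calc ‖w‖ ^ 2 * _ ≤ ‖w‖ ^ 2 * (2 * (-(h * x)) ^ 2) := by gcongr
        _ = 2 * (‖w‖ * |x|) ^ 2 * h ^ 2 := by rw [mul_pow, sq_abs]; ring
        _ ≤ 2 * (1 + 3 * ‖R‖) ^ 2 * ‖h ^ 2‖ := by
          rw [Real.norm_eq_abs, abs_of_nonneg (sq_nonneg h)]
          gcongr
    refine (Asymptotics.IsBigO.of_bound _ (Eventually.of_forall hb)).trans_isLittleO ?_
    simpa using Asymptotics.isLittleO_pow_id (𝕜 := ℝ) (n := 2) (by norm_num)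
  refine ⟨fun t => W t v, ?_, ?_, ?_⟩
  · have : W 0 = R * R := by
      simp only [W]
      have : (fun w : ℂ => w * (w * phase 0 w)) = fun w => w * w := by
        ext w; simp [phase]
      rw [this, cfc_mul (fun w : ℂ => w) (fun w => w) R, cfc_id' ℂ R]
    simp [this]
  · intro t
    simp only [hWG]
    exact hdom _
  · intro t h
    have h1 := ((ContinuousLinearMap.apply ℂ E v).restrictScalars ℝ).hasFDerivAt.comp_hasDerivAt t
      (hder t)
    have h2 : A ⟨W t v, h⟩ = G t v - (3 * Complex.I) • W t v := by
      have h3 := hA (G t v) (hdom _)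
      have h4 : W t v = R (G t v) := by rw [hWG]; rfl
      simp only [h4]
      exact h3
    simp only [h2]
    have h5 : (ContinuousLinearMap.restrictScalars ℝ ((ContinuousLinearMap.apply ℂ E) v))
        (-(Complex.I • (G t - (3 * Complex.I) • W t)))
        = -(Complex.I • (G t v - (3 * Complex.I) • W t v)) := by simp
    rw [h5] at h1
    exact h1

theorem solution_unique {E : Type*} [NormedAddCommGroup E] [InnerProductSpace ℂ E] (A : E →ₗ.[ℂ] E)
    (hsym : ∀ f g : A.domain, inner ℂ (A f) (g : E) = inner ℂ (f : E) (A g))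
    {ψ₀ : E} {ψ φ : ℝ → E}
    (hψ : IsSchrodingerSolution A ψ₀ ψ) (hφ : IsSchrodingerSolution A ψ₀ φ) : ψ = φ := by
  have hd : ∀ t, HasDerivAt (fun s => ‖ψ s - φ s‖ ^ 2) 0 t := by
    intro t
    set f : A.domain := ⟨ψ t, hψ.mem_domain t⟩ - ⟨φ t, hφ.mem_domain t⟩ with hf
    have h1 : HasDerivAt (fun s => ψ s - φ s) (-(Complex.I • A f)) t := by
      have h0 := (hψ.hasDerivAt t (hψ.mem_domain t)).sub (hφ.hasDerivAt t (hφ.mem_domain t))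
      have h00 : -(Complex.I • A f) = -(Complex.I • A ⟨ψ t, hψ.mem_domain t⟩)
          - -(Complex.I • A ⟨φ t, hφ.mem_domain t⟩) := by
        rw [hf, LinearPMap.map_sub, smul_sub]; abel
      rw [h00]
      exact h0
    let _ : InnerProductSpace ℝ E := InnerProductSpace.rclikeToReal ℂ E
    have h2 := h1.norm_sq
    convert h2 using 1
    have h3 : inner ℝ (ψ t - φ t) (-(Complex.I • A f))
        = RCLike.re (inner ℂ (ψ t - φ t) (-(Complex.I • A f))) := rfl
    have h4 : (f : E) = ψ t - φ t := rfl
    have h5 := hsym f f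
    rw [h3, ← h4, inner_neg_right, inner_smul_right]
    have h6 : (inner ℂ (f : E) (A f)).im = 0 := by
      have := inner_conj_symm (𝕜 := ℂ) (f : E) (A f)
      rw [h5] at this
      have := congrArg Complex.im this
      simp only [Complex.conj_im] at this
      linarith
    simp [h6]
  funext t
  have h1 := is_const_of_deriv_eq_zero (fun s => (hd s).differentiableAt) (fun s => (hd s).deriv) t 0
  simp only [hψ.init, hφ.init, sub_self, norm_zero] at h1
  have : ‖ψ t - φ t‖ = 0 := by
    have h2 : ‖ψ t - φ t‖ ^ 2 = 0 := by simpa using h1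
    exact pow_eq_zero_iff (two_ne_zero) |>.1 h2
  exact sub_eq_zero.1 (norm_eq_zero.1 this)

/-- The Hilbert space `ℓ²(S)`; `S` is `ℤ` or the half-line `{1, 2, 3, …}`. -/
abbrev L2 (S : Set ℤ) : Type := lp (fun _ : S => ℂ) 2

/-- Extension by zero of a function on `S` to `ℤ`. -/
noncomputable def zeroExt (S : Set ℤ) (f : S → ℂ) : ℤ → ℂ := Function.extend Subtype.val f 0

/-- The formal action `(Hf)(n) = f(n-1) + f(n+1) + V(n) f(n)` for `n ∈ S`, where `f` is set to zero
outside `S`. On `S = {1, 2, 3, …}` this is the Dirichlet condition `f(0) = 0`. -/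
noncomputable def action (S : Set ℤ) (V : ℤ → ℝ) (f : S → ℂ) : S → ℂ := fun n =>
  zeroExt S f (n - 1) + zeroExt S f (n + 1) + (V n : ℂ) * f n

theorem zeroExt_coe (S : Set ℤ) (f : S → ℂ) (n : S) : zeroExt S f n = f n :=
  Subtype.val_injective.extend_apply f 0 n

theorem zeroExt_of_notMem (S : Set ℤ) (f : S → ℂ) {m : ℤ} (h : m ∉ S) : zeroExt S f m = 0 := by
  rw [zeroExt, Function.extend_apply' _ _ _ (by rintro ⟨a, rfl⟩; exact h a.2)]; rfl

theorem zeroExt_add (S : Set ℤ) (f g : S → ℂ) (m : ℤ) :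
    zeroExt S (f + g) m = zeroExt S f m + zeroExt S g m := by
  by_cases h : m ∈ S
  · lift m to S using h
    simp only [zeroExt_coe, Pi.add_apply]
  · simp [zeroExt_of_notMem S _ h]

theorem zeroExt_smul (S : Set ℤ) (c : ℂ) (f : S → ℂ) (m : ℤ) :
    zeroExt S (c • f) m = c * zeroExt S f m := by
  by_cases h : m ∈ S
  · lift m to S using h
    simp only [zeroExt_coe, Pi.smul_apply, smul_eq_mul]
  · simp [zeroExt_of_notMem S _ h]

theorem action_add (S : Set ℤ) (V : ℤ → ℝ) (f g : S → ℂ) :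
    action S V (f + g) = action S V f + action S V g := by
  ext n; simp only [action, zeroExt_add, Pi.add_apply]; ring

theorem action_smul (S : Set ℤ) (V : ℤ → ℝ) (c : ℂ) (f : S → ℂ) :
    action S V (c • f) = c • action S V f := by
  ext n; simp only [action, zeroExt_smul, Pi.smul_apply, smul_eq_mul]; ring

/-- The discrete Schrödinger operator `H` on `ℓ²(S)` with an arbitrary (possibly unbounded) real
potential, on its natural domain `{f ∈ ℓ²(S) : Hf ∈ ℓ²(S)}`, on which it is self-adjoint. -/
noncomputable def schrodingerOp (S : Set ℤ) (V : ℤ → ℝ) : L2 S →ₗ.[ℂ] L2 S where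
  domain :=
    { carrier := {f | Memℓp (action S V f) 2}
      add_mem' := fun {f g} hf hg => by
        simpa only [Set.mem_ofPred_eq, lp.coeFn_add, action_add] using hf.add hg
      zero_mem' := by
        have := action_smul S V 0 0
        simp only [zero_smul] at this
        simp only [Set.mem_ofPred_eq, lp.coeFn_zero, this]
        exact zero_memℓp
      smul_mem' := fun c f hf => by
        simpa only [Set.mem_ofPred_eq, lp.coeFn_smul, action_smul] using hf.const_smul c }
  toFun :=
    { toFun := fun f => ⟨action S V f.1, f.2⟩
      map_add' := fun f g => lp.ext (action_add S V f.1 g.1)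
      map_smul' := fun c f => lp.ext (action_smul S V c f.1) }

theorem summable_zeroExt (S : Set ℤ) (f : L2 S) :
    HasSum (fun m : ℤ => ‖zeroExt S f m‖ ^ 2) (‖f‖ ^ 2) := by
  have h := lp.hasSum_norm (p := 2) (by simp) f
  simp only [ENNReal.toReal_ofNat, Real.rpow_ofNat] at h
  rw [← hasSum_extend_zero (Subtype.val_injective (p := (· ∈ S)))] at h
  convert h using 2 with m
  by_cases hm : m ∈ S
  · have := Subtype.val_injective.extend_apply (fun n : S => ‖f n‖ ^ 2) 0 (⟨m, hm⟩ : S)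
    have h2 := zeroExt_coe S f ⟨m, hm⟩
    simp only at this h2
    rw [this, h2]
  · rw [zeroExt_of_notMem S _ hm, Function.extend_apply' _ _ _ (by rintro ⟨a, rfl⟩; exact hm a.2)]
    simp

theorem shift_sum_le (S : Set ℤ) (k : ℤ) (f : L2 S) (s : Finset S) :
    ∑ i ∈ s, ‖zeroExt S f ((i : ℤ) + k)‖ ^ (2 : ENNReal).toReal ≤ ‖f‖ ^ (2 : ENNReal).toReal := by
  simp only [ENNReal.toReal_ofNat, Real.rpow_ofNat]
  have h := (Equiv.addRight k).hasSum_iff.2 (summable_zeroExt S f)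
  have := sum_le_hasSum (s.map (Function.Embedding.subtype _)) (fun _ _ => sq_nonneg _) h
  simpa using this

/-- The shift `(f(n + k))` of the extension by zero, restricted to `S`. -/
noncomputable def shift (S : Set ℤ) (k : ℤ) : L2 S →L[ℂ] L2 S :=
  LinearMap.mkContinuous
    { toFun := fun f => ⟨fun n => zeroExt S f ((n : ℤ) + k), memℓp_gen' (shift_sum_le S k f)⟩
      map_add' := fun f g => lp.ext (by ext n; exact zeroExt_add S f g _)
      map_smul' := fun c f => lp.ext (by ext n; exact zeroExt_smul S c f _) } 1
    (fun f => by
      rw [one_mul]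
      exact lp.norm_le_of_forall_sum_le (by simp) (norm_nonneg _) (shift_sum_le S k f))

theorem shift_apply (S : Set ℤ) (k : ℤ) (f : L2 S) (n : S) :
    shift S k f n = zeroExt S f ((n : ℤ) + k) := rfl

theorem norm_shift_le (S : Set ℤ) (k : ℤ) : ‖shift S k‖ ≤ 1 :=
  LinearMap.mkContinuous_norm_le _ zero_le_one _

theorem hasSum_inner_zeroExt (S : Set ℤ) (k : ℤ) (f g : L2 S) :
    HasSum (fun m : ℤ => inner ℂ (zeroExt S f (m + k)) (zeroExt S g m))
      (inner ℂ (shift S k f) g) := by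
  have h := lp.hasSum_inner (𝕜 := ℂ) (shift S k f) g
  rw [← hasSum_extend_zero (Subtype.val_injective (p := (· ∈ S)))] at h
  suffices e : (fun m : ℤ => inner ℂ (zeroExt S f (m + k)) (zeroExt S g m))
      = Function.extend Subtype.val (fun n : S => inner ℂ (shift S k f n) (g n)) 0 by
    rw [e]; exact h
  funext m
  by_cases hm : m ∈ S
  · have := Subtype.val_injective.extend_apply
      (fun n : S => inner ℂ (shift S k f n) (g n)) 0 (⟨m, hm⟩ : S)
    have h2 := zeroExt_coe S g ⟨m, hm⟩
    simp only at this h2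
    rw [this, h2, shift_apply]
  · rw [zeroExt_of_notMem S _ hm, Function.extend_apply' _ _ _ (by rintro ⟨a, rfl⟩; exact hm a.2)]
    simp

theorem inner_shift (S : Set ℤ) (k : ℤ) (f g : L2 S) :
    inner ℂ (shift S k f) g = inner ℂ f (shift S (-k) g) := by
  have h1 := hasSum_inner_zeroExt S k f g
  have h2 := hasSum_inner_zeroExt S (-k) g f
  have h3 := (Equiv.addRight k).hasSum_iff.2 h2
  have h4 := h3.map (starRingEnd ℂ) Complex.continuous_conj
  rw [inner_conj_symm] at h4
  refine h1.unique ?_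
  convert h4 using 2 with m
  simp only [Function.comp, Equiv.coe_addRight, add_neg_cancel_right]
  rw [inner_conj_symm]

/-- The free part `f(n-1) + f(n+1)` of the operator. -/
noncomputable def hop (S : Set ℤ) : L2 S →L[ℂ] L2 S := shift S (-1) + shift S 1

theorem hop_apply (S : Set ℤ) (f : L2 S) (n : S) :
    hop S f n = zeroExt S f (n - 1) + zeroExt S f (n + 1) := rfl

theorem norm_hop_le (S : Set ℤ) : ‖hop S‖ ≤ 2 :=
  (norm_add_le _ _).trans (by linarith [norm_shift_le S (-1), norm_shift_le S 1])

theorem inner_hop (S : Set ℤ) (f g : L2 S) : inner ℂ (hop S f) g = inner ℂ f (hop S g) := by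
  simp only [hop, add_apply, inner_add_left, inner_add_right]
  rw [inner_shift, inner_shift, neg_neg, add_comm]

theorem schrodingerOp_apply (S : Set ℤ) (V : ℤ → ℝ) (f : (schrodingerOp S V).domain) (n : S) :
    schrodingerOp S V f n = hop S f n + (V n : ℂ) * (f : L2 S) n := rfl

theorem schrodingerOp_symmetric (S : Set ℤ) (V : ℤ → ℝ) (f g : (schrodingerOp S V).domain) :
    inner ℂ (schrodingerOp S V f) (g : L2 S) = inner ℂ (f : L2 S) (schrodingerOp S V g) := by
  have h : inner ℂ (schrodingerOp S V f - hop S f) (g : L2 S)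
      = inner ℂ (f : L2 S) (schrodingerOp S V g - hop S g) := by
    rw [lp.inner_eq_tsum, lp.inner_eq_tsum]
    congr 1
    ext n
    rw [lp.coeFn_sub, lp.coeFn_sub, Pi.sub_apply, Pi.sub_apply, schrodingerOp_apply,
      schrodingerOp_apply]
    simp only [RCLike.inner_apply, add_sub_cancel_left, map_mul, Complex.conj_ofReal]
    ring
  rw [inner_sub_left, inner_sub_right, inner_hop] at h
  exact sub_left_injective h

theorem mul_sum_le (S : Set ℤ) (c : S → ℂ) (hc : ∀ n, ‖c n‖ ≤ 1 / 3) (f : L2 S) (s : Finset S) :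
    ∑ i ∈ s, ‖c i * f i‖ ^ (2 : ENNReal).toReal ≤ (1 / 3 * ‖f‖) ^ (2 : ENNReal).toReal := by
  have h := lp.sum_rpow_le_norm_rpow (p := 2) (by simp) f s
  simp only [ENNReal.toReal_ofNat, Real.rpow_ofNat] at h ⊢
  calc ∑ i ∈ s, ‖c i * f i‖ ^ 2 ≤ ∑ i ∈ s, (1 / 3) ^ 2 * ‖f i‖ ^ 2 := by
        gcongr with i _
        rw [norm_mul, mul_pow]
        gcongr
        exact hc i
    _ = (1 / 3) ^ 2 * ∑ i ∈ s, ‖f i‖ ^ 2 := by rw [Finset.mul_sum]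
    _ ≤ (1 / 3) ^ 2 * ‖f‖ ^ 2 := by gcongr
    _ = _ := by ring

/-- Multiplication by a function that is bounded by `1 / 3`. -/
noncomputable def mulOp (S : Set ℤ) (c : S → ℂ) (hc : ∀ n, ‖c n‖ ≤ 1 / 3) : L2 S →L[ℂ] L2 S :=
  LinearMap.mkContinuous
    { toFun := fun f => ⟨fun n => c n * f n, memℓp_gen' (mul_sum_le S c hc f)⟩
      map_add' := fun f g => lp.ext (by ext n; exact mul_add _ _ _)
      map_smul' := fun a f => lp.ext (by ext n; exact mul_left_comm _ _ _) } (1 / 3)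
    (fun f => lp.norm_le_of_forall_sum_le (by simp) (by positivity) (mul_sum_le S c hc f))

/-- Both resolvents `(H + σ 3 i)⁻¹`, `σ = ± 1`, exist as bounded operators. -/
theorem exists_resolvent (S : Set ℤ) (V : ℤ → ℝ) (σ : ℝ) (hσ : |σ| = 1) :
    ∃ R : L2 S →L[ℂ] L2 S, (∀ v, ∃ h : R v ∈ (schrodingerOp S V).domain,
      schrodingerOp S V ⟨R v, h⟩ = v - (σ * (3 * Complex.I)) • R v) ∧
      ∀ f : (schrodingerOp S V).domain,
        R (schrodingerOp S V f + (σ * (3 * Complex.I)) • (f : L2 S)) = f := by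
  set z : ℂ := σ * (3 * Complex.I) with hz
  have him : ∀ n : S, 3 ≤ ‖(V n : ℂ) + z‖ := fun n => by
    have h := Complex.abs_im_le_norm ((V n : ℂ) + z)
    have : ((V n : ℂ) + z).im = σ * 3 := by simp [hz]
    rw [this, abs_mul, hσ] at h
    norm_num at h
    exact h
  have hne : ∀ n : S, (V n : ℂ) + z ≠ 0 := fun n h => by
    have := him n
    rw [h, norm_zero] at this
    linarith
  have hc : ∀ n : S, ‖((V n : ℂ) + z)⁻¹‖ ≤ 1 / 3 := fun n => by
    rw [norm_inv, ← one_div]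
    exact one_div_le_one_div_of_le (by norm_num) (him n)
  set m : L2 S →L[ℂ] L2 S := mulOp S _ hc with hm
  have hmn : ∀ (f : L2 S) (n : S), ((V n : ℂ) + z) * m f n = f n := fun f n => by
    have : m f n = ((V n : ℂ) + z)⁻¹ * f n := rfl
    rw [this, mul_inv_cancel_left₀ (hne n)]
  have hnm : ‖m‖ ≤ 1 / 3 := LinearMap.mkContinuous_norm_le _ (by norm_num) _
  have hlt : ‖-(hop S * m)‖ < 1 := by
    rw [norm_neg]
    calc ‖hop S * m‖ ≤ ‖hop S‖ * ‖m‖ := norm_mul_le _ _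
      _ ≤ 2 * (1 / 3) := by gcongr; exact norm_hop_le S
      _ < 1 := by norm_num
  obtain ⟨u, hu⟩ := isUnit_one_sub_of_norm_lt_one hlt
  rw [sub_neg_eq_add] at hu
  set Q : L2 S →L[ℂ] L2 S := ↑u⁻¹ with hQ
  have hQ1 : (1 + hop S * m) * Q = 1 := by rw [← hu]; exact u.mul_inv
  have hQ2 : Q * (1 + hop S * m) = 1 := by rw [← hu]; exact u.inv_mul
  have hact : ∀ v, action S V (m (Q v)) = ⇑(v - z • m (Q v)) := fun v => by
    ext n
    have h1 : (Q v + hop S (m (Q v))) = v := DFunLike.congr_fun hQ1 v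
    have h2 := hmn (Q v) n
    have h3 : action S V (m (Q v)) n = hop S (m (Q v)) n + (V n : ℂ) * m (Q v) n := rfl
    have h4 : Q v n + hop S (m (Q v)) n = v n := by
      conv_rhs => rw [← h1]
      rfl
    rw [h3, lp.coeFn_sub, lp.coeFn_smul, Pi.sub_apply, Pi.smul_apply, smul_eq_mul]
    linear_combination h2 + h4
  refine ⟨m * Q, fun v => ⟨?_, ?_⟩, fun f => ?_⟩
  · change Memℓp (action S V (m (Q v))) 2
    rw [hact]
    exact lp.memℓp _
  · exact lp.ext (hact v)
  · set g : L2 S := schrodingerOp S V f + z • (f : L2 S) - hop S f with hg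
    have h1 : m g = f := by
      refine lp.ext (funext fun n => ?_)
      have h2 : m g n = ((V n : ℂ) + z)⁻¹ * g n := rfl
      have h3 : g n = ((V n : ℂ) + z) * (f : L2 S) n := by
        rw [hg, lp.coeFn_sub, lp.coeFn_add, lp.coeFn_smul, Pi.sub_apply, Pi.add_apply,
          schrodingerOp_apply, Pi.smul_apply, smul_eq_mul]
        ring
      rw [h2, h3, inv_mul_cancel_left₀ (hne n)]
    have h4 : schrodingerOp S V f + z • (f : L2 S) = (1 + hop S * m) g := by
      change _ = g + hop S (m g)
      rw [h1, hg]; abel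
    have h5 : Q ((1 + hop S * m) g) = g := DFunLike.congr_fun hQ2 g
    rw [h4]
    change m (Q _) = _
    rw [h5, h1]

theorem memℓp_of_finite_support (S : Set ℤ) (f : S → ℂ) (hf : (Function.support f).Finite) :
    Memℓp f 2 := (memℓp_zero hf).of_exponent_ge zero_le

theorem finite_support_action (S : Set ℤ) (V : ℤ → ℝ) (f : S → ℂ)
    (hf : (Function.support f).Finite) : (Function.support (action S V f)).Finite := by
  have h1 : (Function.support (zeroExt S f)).Finite := by
    refine (hf.image Subtype.val).subset fun m hm => ?_
    by_cases h : m ∈ S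
    · refine ⟨⟨m, h⟩, ?_, rfl⟩
      intro h0
      exact hm ((zeroExt_coe S f ⟨m, h⟩).trans h0)
    · exact absurd (zeroExt_of_notMem S f h) hm
  have h2 : ∀ k : ℤ, {n : S | zeroExt S f (n + k) ≠ 0}.Finite := fun k =>
    h1.preimage (f := fun n : S => (n : ℤ) + k)
      (fun a _ b _ hab => Subtype.ext (by simpa using hab))
  refine (((h2 (-1)).union (h2 1)).union hf).subset fun n hn => ?_
  by_contra hcon
  simp only [Set.mem_union, Set.mem_ofPred_eq, Function.mem_support, not_or, not_not] at hcon
  refine hn ?_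
  have h3 : zeroExt S f (n - 1) = 0 := hcon.1.1
  simp [action, h3, hcon.1.2, hcon.2]

theorem finite_support_delta (S : Set ℤ) :
    (Function.support fun n : S => if (n : ℤ) = 1 then (1 : ℂ) else 0).Finite := by
  refine Set.Subsingleton.finite fun a ha b hb => Subtype.ext ?_
  simp only [Function.mem_support, ne_eq, ite_eq_right_iff, one_ne_zero, imp_false, not_not] at ha hb
  rw [ha, hb]

/-- The initial state `δ₁`. -/
noncomputable def delta₁ (S : Set ℤ) : L2 S :=
  ⟨fun n => if (n : ℤ) = 1 then 1 else 0, memℓp_of_finite_support S _ (finite_support_delta S)⟩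

theorem exists_evolution (S : Set ℤ) (V : ℤ → ℝ) :
    ∃ ψ, IsSchrodingerSolution (schrodingerOp S V) (delta₁ S) ψ := by
  obtain ⟨R, hR, hR'⟩ := exists_resolvent S V 1 (by simp)
  obtain ⟨Q, hQ, hQ'⟩ := exists_resolvent S V (-1) (by simp)
  simp only [Complex.ofReal_one, one_mul, Complex.ofReal_neg, neg_mul] at hR hR' hQ hQ'
  choose hRd hRa using hR
  choose hQd hQa using hQ
  have hadj : star R = Q := by
    rw [ContinuousLinearMap.star_eq_adjoint]
    refine ((ContinuousLinearMap.eq_adjoint_iff Q R).2 fun u v => ?_).symm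
    have h := schrodingerOp_symmetric S V ⟨Q u, hQd u⟩ ⟨R v, hRd v⟩
    rw [hRa, hQa] at h
    simp only [inner_sub_left, inner_sub_right, inner_smul_left, inner_smul_right] at h
    simp [Complex.conj_ofNat] at h
    linear_combination -h
  have hdiff1 : ∀ v, Q v - R v = (6 * Complex.I) • R (Q v) := fun v => by
    have h := hR' (⟨Q v, hQd v⟩)
    rw [hQa] at h
    simp only [map_add, map_sub, map_smul, neg_smul, map_neg] at h
    rw [sub_eq_iff_eq_add]
    refine h.symm.trans ?_
    module
  have hdiff2 : ∀ v, Q v - R v = (6 * Complex.I) • Q (R v) := fun v => by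
    have h := hQ' (⟨R v, hRd v⟩)
    rw [hRa] at h
    simp only [map_add, map_sub, map_smul, neg_smul, map_neg] at h
    generalize Q (R v) = c at h ⊢
    rw [← h]
    module
  have h6 : (6 * Complex.I) ≠ 0 := by simp
  have hfin := finite_support_delta S
  have hd1 : delta₁ S ∈ (schrodingerOp S V).domain :=
    memℓp_of_finite_support S _ (finite_support_action S V _ hfin)
  set v₁ : L2 S := schrodingerOp S V ⟨_, hd1⟩ + (3 * Complex.I) • delta₁ S with hv₁
  have hd2 : v₁ ∈ (schrodingerOp S V).domain := by
    refine Submodule.add_mem _ ?_ (Submodule.smul_mem _ _ hd1)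
    exact memℓp_of_finite_support S _
      (finite_support_action S V _ (finite_support_action S V _ hfin))
  have h1 : R v₁ = delta₁ S := hR' ⟨_, hd1⟩
  have h2 := hR' ⟨_, hd2⟩
  have h3 := exists_solution_of_resolvent (schrodingerOp S V) R
    (by
      rw [hadj]
      ext1 v
      exact smul_right_injective _ h6 ((hdiff2 v).symm.trans (hdiff1 v)))
    (by rw [hadj]; ext1 v; exact hdiff1 v) hRd (fun v _ => hRa v)
    (schrodingerOp S V ⟨_, hd2⟩ + (3 * Complex.I) • v₁)
  rw [h2] at h3
  simpa only [h1] using h3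

theorem evolution_unique (S : Set ℤ) (V : ℤ → ℝ) {ψ φ : ℝ → L2 S}
    (hψ : IsSchrodingerSolution (schrodingerOp S V) (delta₁ S) ψ)
    (hφ : IsSchrodingerSolution (schrodingerOp S V) (delta₁ S) φ) : ψ = φ :=
  solution_unique _ (schrodingerOp_symmetric S V) hψ hφ

/-- The evolved state `ψ(t) = exp (-i t H) δ₁`. -/
noncomputable def evolution (S : Set ℤ) (V : ℤ → ℝ) : ℝ → L2 S :=
  Classical.choose (exists_evolution S V)

theorem evolution_spec (S : Set ℤ) (V : ℤ → ℝ) :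
    IsSchrodingerSolution (schrodingerOp S V) (delta₁ S) (evolution S V) :=
  Classical.choose_spec (exists_evolution S V)

/-- The time-averaged probability `a(n,T) = (1/T) ∫₀^∞ exp (-2t/T) |ψ(t,n)|² dt`. -/
noncomputable def avgProb (S : Set ℤ) (V : ℤ → ℝ) (n : S) (T : ℝ) : ENNReal :=
  ENNReal.ofReal (1 / T) * ∫⁻ t in Set.Ioi (0 : ℝ),
    ENNReal.ofReal (Real.exp (-2 * t / T) * ‖evolution S V t n‖ ^ 2)

/-- The time-averaged moment `⟨|X|^p⟩(T) = ∑ₙ |n|^p a(n,T)`, a priori possibly infinite. -/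
noncomputable def moment (S : Set ℤ) (V : ℤ → ℝ) (p T : ℝ) : ENNReal :=
  ∑' n : S, ENNReal.ofReal (|((n : ℤ) : ℝ)| ^ p) * avgProb S V n T

/-- The lower growth exponent `β⁻(p) = liminf_{T → ∞} log ⟨|X|^p⟩(T) / log T`, an extended real
number (with `log 0 = -∞` and `log ∞ = ∞`). -/
noncomputable def betaMinus (S : Set ℤ) (V : ℤ → ℝ) (p : ℝ) : EReal :=
  liminf (fun T : ℝ => ENNReal.log (moment S V p T) / ((Real.log T : ℝ) : EReal)) atTop

/-- The one-step matrix `A(n,z)`. -/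
noncomputable def stepMatrix (V : ℤ → ℝ) (z : ℂ) (n : ℤ) : Matrix (Fin 2) (Fin 2) ℂ :=
  !![z - (V n : ℂ), -1; 1, 0]

/-- The product `A(m+k,z) A(m+k-1,z) ⋯ A(m+1,z)`. -/
noncomputable def stepProd (V : ℤ → ℝ) (z : ℂ) (m : ℤ) : ℕ → Matrix (Fin 2) (Fin 2) ℂ
  | 0 => 1
  | k + 1 => stepMatrix V z (m + (k + 1)) * stepProd V z m k

/-- The transfer matrix `T(n,m;z)`: the product `A(n,z) ⋯ A(m+1,z)` for `n > m`, the identity for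
`n = m`, and `T(m,n;z)⁻¹` for `n < m`. -/
noncomputable def transfer (V : ℤ → ℝ) (n m : ℤ) (z : ℂ) : Matrix (Fin 2) (Fin 2) ℂ :=
  if m ≤ n then stepProd V z m (n - m).toNat else (stepProd V z n (m - n).toNat)⁻¹

/-- The operator norm of a `2 × 2` matrix with respect to the Euclidean norm on `ℂ²`. -/
noncomputable def matNorm (M : Matrix (Fin 2) (Fin 2) ℂ) : ℝ :=
  ‖Matrix.toEuclideanCLM (n := Fin 2) (𝕜 := ℂ) M‖

end OneEnergy

/-!
Put `w = 2/T - iE₀`. The Laplace transform `u = ∫₀^∞ e^{-wt} ψ(t) dt` solves `(H - z)u = -iδ₁` with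
`z = iw = E₀ + 2i/T`, and Cauchy–Schwarz for the measure `e^{-2t/T} dt` gives
`(2/T²)|u(n)|² ≤ a(n,T)`. The source at `1` forces `|u(0)|` or `|(u(2), u(1))|` to be bounded below.
Since `|z - E₀| = 2/T`, variation of parameters around `E₀` shows that over distances `2M` with
`M^{1+α} ≪ T` the vectors `(u(n+1), u(n))` shrink at most by a factor of order `M^α`. Hence
`∑_{M ≤ |n| ≤ 2M} |u(n)|² ≳ M^{1-2α}` and `⟨|X|^p⟩(T) ≳ M^{p+1-2α} T^{-2}`; take
`M ~ T^{1/(1+α)}`.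
-/

namespace OneEnergy

section Unitarity

variable {E : Type*} [NormedAddCommGroup E] [InnerProductSpace ℂ E] {A : E →ₗ.[ℂ] E}

theorem re_inner_neg_I_smul_self (hA : A.IsFormalAdjoint A) (x : A.domain) :
    RCLike.re (inner ℂ (x : E) (-(Complex.I • A x))) = 0 := by
  have h_real : (inner ℂ (x : E) (A x)).im = 0 := by
    rw [← Complex.conj_eq_iff_im, inner_conj_symm, hA x x]
  simp [inner_smul_right, h_real]

theorem IsSchrodingerSolution.norm_eq (hA : A.IsFormalAdjoint A) {ψ₀ : E} {ψ : ℝ → E}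
    (hψ : IsSchrodingerSolution A ψ₀ ψ) (t : ℝ) : ‖ψ t‖ = ‖ψ₀‖ := by
  let _ : InnerProductSpace ℝ E := InnerProductSpace.rclikeToReal ℂ E
  have hderiv (s : ℝ) : HasDerivAt (fun s ↦ ‖ψ s‖ ^ 2) 0 s := by
    refine (hψ.hasDerivAt s (hψ.mem_domain s)).norm_sq.congr_deriv ?_
    rw [real_inner_eq_re_inner ℂ, re_inner_neg_I_smul_self hA ⟨ψ s, hψ.mem_domain s⟩, mul_zero]
  have hconst := is_const_of_deriv_eq_zero (fun s ↦ (hderiv s).differentiableAt)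
    (fun s ↦ (hderiv s).deriv) t 0
  rw [← hψ.init]
  exact (pow_left_inj₀ (norm_nonneg _) (norm_nonneg _) two_ne_zero).1 hconst

theorem IsSchrodingerSolution.continuous {ψ₀ : E} {ψ : ℝ → E}
    (hψ : IsSchrodingerSolution A ψ₀ ψ) : Continuous ψ :=
  continuous_iff_continuousAt.2 fun t ↦ (hψ.hasDerivAt t (hψ.mem_domain t)).continuousAt

end Unitarity

section Coordinates

variable (S : Set ℤ)

theorem norm_zeroExt_le (f : L2 S) (m : ℤ) : ‖zeroExt S f m‖ ≤ ‖f‖ := by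
  have hsq : ‖zeroExt S f m‖ ^ 2 ≤ ‖f‖ ^ 2 :=
    le_hasSum (summable_zeroExt S f) m fun _ _ ↦ by positivity
  exact (pow_le_pow_iff_left₀ (norm_nonneg _) (norm_nonneg _) two_ne_zero).1 hsq

/-- The `m`-th coordinate of the zero extension, as a continuous functional on `ℓ²(S)`. -/
noncomputable def zeroExtCLM (m : ℤ) : L2 S →L[ℂ] ℂ :=
  LinearMap.mkContinuous
    { toFun := fun f ↦ zeroExt S f m
      map_add' := fun f g ↦ zeroExt_add S f g m
      map_smul' := fun c f ↦ zeroExt_smul S c f m }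
    1 fun f ↦ (norm_zeroExt_le S f m).trans (one_mul ‖f‖).ge

@[simp]
theorem zeroExtCLM_apply (m : ℤ) (f : L2 S) : zeroExtCLM S m f = zeroExt S f m := rfl

/-- The value of `Hf` at `n`, as a continuous functional: unlike `H` itself it is defined on all of
`ℓ²(S)`. -/
noncomputable def actionCLM (V : ℤ → ℝ) (n : ℤ) : L2 S →L[ℂ] ℂ :=
  zeroExtCLM S (n - 1) + zeroExtCLM S (n + 1) + (V n : ℂ) • zeroExtCLM S n

@[simp]
theorem actionCLM_apply (V : ℤ → ℝ) (n : ℤ) (f : L2 S) :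
    actionCLM S V n f =
      zeroExt S f (n - 1) + zeroExt S f (n + 1) + (V n : ℂ) * zeroExt S f n := rfl

variable {S}

theorem zeroExtCLM_schrodingerOp {V : ℤ → ℝ} {n : ℤ} (hn : n ∈ S) (f : (schrodingerOp S V).domain) :
    zeroExtCLM S n (schrodingerOp S V f) = actionCLM S V n f := by
  lift n to S using hn
  rw [zeroExtCLM_apply, actionCLM_apply, zeroExt_coe, zeroExt_coe, schrodingerOp_apply, hop_apply]

end Coordinates

section Laplace

open MeasureTheory

variable {E : Type*} [NormedAddCommGroup E] [NormedSpace ℂ E]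

/-- The Laplace transform `∫₀^∞ e^{-wt} f(t) dt`. -/
noncomputable def laplace (f : ℝ → E) (w : ℂ) : E :=
  ∫ t in Set.Ioi (0 : ℝ), Complex.exp (-w * t) • f t

theorem norm_exp_neg_mul_ofReal (w : ℂ) (t : ℝ) :
    ‖Complex.exp (-w * t)‖ = Real.exp (-w.re * t) := by
  simp [Complex.norm_exp]

theorem integrableOn_exp_smul {f : ℝ → E} {K : ℝ} {w : ℂ} (hw : 0 < w.re) (hf : Continuous f)
    (hK : ∀ t, ‖f t‖ ≤ K) :
    IntegrableOn (fun t : ℝ ↦ Complex.exp (-w * t) • f t) (Set.Ioi 0) :=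
  (integrableOn_exp_mul_complex_Ioi (a := -w) (by simpa using hw) 0).smul_bdd K
    hf.aestronglyMeasurable (Eventually.of_forall hK)

theorem tendsto_exp_smul_atTop {f : ℝ → E} {K : ℝ} {w : ℂ} (hw : 0 < w.re)
    (hK : ∀ t, ‖f t‖ ≤ K) :
    Tendsto (fun t : ℝ ↦ Complex.exp (-w * t) • f t) atTop (𝓝 0) := by
  have hexp : Tendsto (fun t : ℝ ↦ Real.exp (-w.re * t) * K) atTop (𝓝 0) := by
    have := (Real.tendsto_exp_neg_atTop_nhds_zero.comp
      (tendsto_id.const_mul_atTop hw)).mul_const K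
    simpa [Function.comp_def] using this
  refine squeeze_zero_norm (fun t ↦ ?_) hexp
  rw [norm_smul, norm_exp_neg_mul_ofReal]
  gcongr
  exact hK t

theorem map_laplace [CompleteSpace E] {F : Type*} [NormedAddCommGroup F] [NormedSpace ℂ F]
    [CompleteSpace F] {f : ℝ → E} {K : ℝ} {w : ℂ} (hw : 0 < w.re) (hf : Continuous f)
    (hK : ∀ t, ‖f t‖ ≤ K) (L : E →L[ℂ] F) :
    L (laplace f w) = laplace (fun t ↦ L (f t)) w := by
  rw [laplace, laplace, ← L.integral_comp_comm (integrableOn_exp_smul hw hf hK)]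
  simp only [map_smul]

/-- Integration by parts: the Laplace transform turns the evolution equation into an algebraic one. -/
theorem map_laplace_of_hasDerivAt [CompleteSpace E] {F : Type*} [NormedAddCommGroup F]
    [NormedSpace ℂ F] [CompleteSpace F] {ψ : ℝ → E} {K : ℝ} {w : ℂ} (hw : 0 < w.re)
    (hψ : Continuous ψ) (hK : ∀ t, ‖ψ t‖ ≤ K) {L L' : E →L[ℂ] F}
    (hderiv : ∀ t, HasDerivAt (fun s ↦ L (ψ s)) (L' (ψ t)) t) :
    L' (laplace ψ w) = w • L (laplace ψ w) - L (ψ 0) := by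
  have hint (l : E →L[ℂ] F) :
      IntegrableOn (fun t : ℝ ↦ Complex.exp (-w * t) • l (ψ t)) (Set.Ioi 0) :=
    integrableOn_exp_smul hw (l.continuous.comp hψ) fun t ↦ l.le_opNorm_of_le (hK t)
  have hint_smul :
      IntegrableOn (fun t : ℝ ↦ w • Complex.exp (-w * t) • L (ψ t)) (Set.Ioi 0) :=
    (hint L).smul w
  have hexp (t : ℝ) : HasDerivAt (fun t : ℝ ↦ Complex.exp (-w * t))
      (Complex.exp (-w * t) * (-w * 1)) t :=
    ((Complex.ofRealCLM.hasDerivAt (x := t)).const_mul (-w)).cexp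
  have hprod (t : ℝ) : HasDerivAt (fun t : ℝ ↦ Complex.exp (-w * t) • L (ψ t))
      (Complex.exp (-w * t) • L' (ψ t) - w • Complex.exp (-w * t) • L (ψ t)) t := by
    refine ((hexp t).smul (hderiv t)).congr_deriv ?_
    module
  have hftc := integral_Ioi_of_hasDerivAt_of_tendsto (hprod 0).continuousAt.continuousWithinAt
    (fun t _ ↦ hprod t) ((hint L').sub hint_smul)
    (tendsto_exp_smul_atTop hw fun t ↦ L.le_opNorm_of_le (hK t))
  rw [integral_sub (hint L') hint_smul, integral_smul, Complex.ofReal_zero, mul_zero,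
    Complex.exp_zero, one_smul, sub_eq_iff_eq_add] at hftc
  rw [map_laplace hw hψ hK, map_laplace hw hψ hK]
  exact hftc.trans (by rw [zero_sub, neg_add_eq_sub, laplace])

theorem integrableOn_exp_mul_norm_sq {F : Type*} [NormedAddCommGroup F] {f : ℝ → F} {c K : ℝ}
    (hc : 0 < c) (hf : Continuous f) (hK : ∀ t, ‖f t‖ ≤ K) :
    IntegrableOn (fun t : ℝ ↦ Real.exp (-c * t) * ‖f t‖ ^ 2) (Set.Ioi 0) := by
  refine (integrableOn_exp_mul_Ioi (neg_neg_of_pos hc) 0).mul_bdd (c := K ^ 2)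
    (hf.norm.pow 2).aestronglyMeasurable (ae_of_all _ fun t ↦ ?_)
  rw [norm_pow, norm_norm]
  gcongr
  exact hK t

/-- The Cauchy–Schwarz inequality for the finite measure `e^{-ct} dt` of total mass `1/c`. -/
theorem re_mul_norm_laplace_sq_le {f : ℝ → E} {K : ℝ} {w : ℂ} (hw : 0 < w.re)
    (hf : Continuous f) (hK : ∀ t, ‖f t‖ ≤ K) :
    w.re * ‖laplace f w‖ ^ 2 ≤ ∫ t in Set.Ioi (0 : ℝ), Real.exp (-w.re * t) * ‖f t‖ ^ 2 := by
  have hint : IntegrableOn (fun t : ℝ ↦ Real.exp (-w.re * t)) (Set.Ioi 0) :=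
    integrableOn_exp_mul_Ioi (neg_neg_of_pos hw) 0
  have hint_sq := integrableOn_exp_mul_norm_sq hw hf hK
  have hmass : ∫ t in Set.Ioi (0 : ℝ), Real.exp (-w.re * t) = w.re⁻¹ := by
    rw [integral_exp_mul_Ioi (neg_neg_of_pos hw), mul_zero, Real.exp_zero, neg_div_neg_eq, one_div]
  set s := w.re * ‖laplace f w‖ with hs
  have hamgm : 2 * s * ‖laplace f w‖
      ≤ (∫ t in Set.Ioi (0 : ℝ), Real.exp (-w.re * t) * ‖f t‖ ^ 2) + s ^ 2 * w.re⁻¹ := by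
    calc 2 * s * ‖laplace f w‖
        ≤ 2 * s * ∫ t in Set.Ioi (0 : ℝ), ‖Complex.exp (-w * t) • f t‖ := by
          gcongr
          exact norm_integral_le_integral_norm _
      _ = ∫ t in Set.Ioi (0 : ℝ), 2 * s * ‖Complex.exp (-w * t) • f t‖ :=
          (integral_const_mul _ _).symm
      _ ≤ ∫ t in Set.Ioi (0 : ℝ),
            (Real.exp (-w.re * t) * ‖f t‖ ^ 2 + s ^ 2 * Real.exp (-w.re * t)) := by
          refine integral_mono ((integrableOn_exp_smul hw hf hK).norm.const_mul _)
            (hint_sq.add (hint.const_mul _)) fun t ↦ ?_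
          simp only [norm_smul, norm_exp_neg_mul_ofReal]
          nlinarith [mul_nonneg (Real.exp_nonneg (-w.re * t)) (sq_nonneg (‖f t‖ - s))]
      _ = _ := by rw [integral_add hint_sq (hint.const_mul _), integral_const_mul, hmass]
  have hs_sq : s ^ 2 * w.re⁻¹ = s * ‖laplace f w‖ := by rw [hs]; field_simp
  linarith

end Laplace

theorem zeroExt_laplace_eq {S : Set ℤ} {V : ℤ → ℝ} {ψ₀ : L2 S} {ψ : ℝ → L2 S} {w : ℂ}
    (hψ : IsSchrodingerSolution (schrodingerOp S V) ψ₀ ψ) (hw : 0 < w.re) {n : ℤ} (hn : n ∈ S) :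
    actionCLM S V n (laplace ψ w) =
      Complex.I * w * zeroExt S (laplace ψ w : L2 S) n - Complex.I * zeroExt S ψ₀ n := by
  have hderiv (t : ℝ) : HasDerivAt (fun s ↦ zeroExtCLM S n (ψ s))
      ((-Complex.I • actionCLM S V n) (ψ t)) t := by
    refine (((zeroExtCLM S n).restrictScalars ℝ).hasFDerivAt.comp_hasDerivAt t
      (hψ.hasDerivAt t (hψ.mem_domain t))).congr_deriv ?_
    rw [ContinuousLinearMap.coe_restrictScalars', map_neg, map_smul, zeroExtCLM_schrodingerOp hn,
      smul_apply, neg_smul]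
  have h := map_laplace_of_hasDerivAt hw hψ.continuous
    (fun t ↦ (hψ.norm_eq (schrodingerOp_symmetric S V) t).le) hderiv
  rw [smul_apply, hψ.init, zeroExtCLM_apply, zeroExtCLM_apply, smul_eq_mul,
    smul_eq_mul] at h
  linear_combination Complex.I * h + actionCLM S V n (laplace ψ w) * Complex.I_sq

section Moment

open MeasureTheory

variable (S : Set ℤ) (V : ℤ → ℝ)

theorem ofReal_norm_laplace_sq_le_avgProb {T : ℝ} (hT : 0 < T) {w : ℂ} (hw : w.re = 2 / T)
    (n : S) :
    ENNReal.ofReal (2 / T ^ 2 * ‖zeroExt S (laplace (evolution S V) w : L2 S) n‖ ^ 2)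
      ≤ avgProb S V n T := by
  have hw₀ : 0 < w.re := hw ▸ by positivity
  have hψ := evolution_spec S V
  have hbound (t : ℝ) : ‖evolution S V t‖ ≤ ‖delta₁ S‖ :=
    (hψ.norm_eq (schrodingerOp_symmetric S V) t).le
  set ψn : ℝ → ℂ := fun t ↦ zeroExtCLM S n (evolution S V t) with hψn
  have hcont : Continuous ψn := (zeroExtCLM S n).continuous.comp hψ.continuous
  have hbound' (t : ℝ) : ‖ψn t‖ ≤ ‖delta₁ S‖ := (norm_zeroExt_le S _ _).trans (hbound t)
  have havg : avgProb S V n T =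
      ENNReal.ofReal (1 / T * ∫ t in Set.Ioi (0 : ℝ), Real.exp (-w.re * t) * ‖ψn t‖ ^ 2) := by
    rw [avgProb, ENNReal.ofReal_mul (by positivity), ofReal_integral_eq_lintegral_ofReal
      (integrableOn_exp_mul_norm_sq hw₀ hcont hbound') (ae_of_all _ fun t ↦ by positivity)]
    simp only [hw, hψn, zeroExtCLM_apply, zeroExt_coe, neg_mul, neg_div, div_mul_eq_mul_div]
  rw [havg, ← zeroExtCLM_apply, map_laplace hw₀ hψ.continuous hbound]
  refine ENNReal.ofReal_le_ofReal ?_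
  calc 2 / T ^ 2 * ‖laplace ψn w‖ ^ 2
      = 1 / T * (w.re * ‖laplace ψn w‖ ^ 2) := by rw [hw]; ring
    _ ≤ _ := by gcongr; exact re_mul_norm_laplace_sq_le hw₀ hcont hbound'

theorem ofReal_sum_laplace_le_moment {T : ℝ} (hT : 0 < T) {w : ℂ} (hw : w.re = 2 / T) {p a : ℝ}
    (ha : 0 ≤ a) {F : Finset ℤ} (hF : ∀ m ∈ F, a ≤ |(m : ℝ)| ^ p) :
    ENNReal.ofReal
        (a * (2 / T ^ 2) * ∑ m ∈ F, ‖zeroExt S (laplace (evolution S V) w : L2 S) m‖ ^ 2)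
      ≤ moment S V p T := by
  classical
  have hsum : ∑ m ∈ F, ‖zeroExt S (laplace (evolution S V) w : L2 S) m‖ ^ 2
      = ∑ n ∈ F.subtype (· ∈ S), ‖zeroExt S (laplace (evolution S V) w : L2 S) n‖ ^ 2 := by
    rw [Finset.sum_subtype_eq_sum_filter
      (f := fun m : ℤ ↦ ‖zeroExt S (laplace (evolution S V) w : L2 S) m‖ ^ 2),
      Finset.sum_filter_of_ne]
    intro m _ hm
    by_contra hmS
    exact hm (by rw [zeroExt_of_notMem S _ hmS]; simp)
  rw [hsum, Finset.mul_sum, ENNReal.ofReal_sum_of_nonneg fun _ _ ↦ by positivity]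
  refine (Finset.sum_le_sum fun n hn ↦ ?_).trans (ENNReal.sum_le_tsum _)
  rw [mul_assoc, ENNReal.ofReal_mul ha]
  gcongr
  · exact hF n (Finset.mem_subtype.1 hn)
  · exact ofReal_norm_laplace_sq_le_avgProb S V hT hw n

end Moment

section Transfer

variable (V : ℤ → ℝ) (z : ℂ)

theorem det_stepMatrix (n : ℤ) : (stepMatrix V z n).det = 1 := by
  simp [stepMatrix, Matrix.det_fin_two]

theorem stepProd_succ_right (m : ℤ) (k : ℕ) :
    stepProd V z m (k + 1) = stepProd V z (m + 1) k * stepMatrix V z (m + 1) := by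
  induction k with
  | zero => simp [stepProd]
  | succ k ih =>
    rw [stepProd, ih, stepProd, Matrix.mul_assoc]
    congr 2
    push_cast
    ring

theorem transfer_add_left (m : ℤ) (k : ℕ) : transfer V (m + k) m z = stepProd V z m k := by
  simp [transfer]

theorem transfer_add_right (m : ℤ) (k : ℕ) : transfer V m (m + k) z = (stepProd V z m k)⁻¹ := by
  rcases k with _ | k
  · simp [transfer, stepProd]
  · rw [transfer, if_neg (by push_cast; lia), add_sub_cancel_left, Int.toNat_natCast]

theorem transfer_self (n : ℤ) : transfer V n n z = 1 := by
  simp [transfer, stepProd]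

theorem transfer_mul_stepMatrix (x k : ℤ) :
    transfer V x k z * stepMatrix V z k = transfer V x (k - 1) z := by
  obtain ⟨m, rfl⟩ : ∃ m, k = m + 1 := ⟨k - 1, by ring⟩
  rw [add_sub_cancel_right]
  rcases le_or_gt (m + 1) x with h | h
  · obtain ⟨j, rfl⟩ := Int.le.dest h
    have hsplit := transfer_add_left V z m (j + 1)
    rw [transfer_add_left, ← stepProd_succ_right, ← hsplit]
    congr 1
    push_cast
    ring
  · obtain ⟨j, rfl⟩ := Int.le.dest (Int.lt_add_one_iff.1 h)
    have hsplit := transfer_add_right V z x (j + 1)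
    push_cast at hsplit
    rw [transfer_add_right, add_assoc, hsplit, stepProd, Matrix.mul_inv_rev, Matrix.mul_assoc,
      Matrix.nonsing_inv_mul _ (by rw [det_stepMatrix]; exact isUnit_one), Matrix.mul_one]

/-- The transfer matrix `T(n,m;z)` acting on the Euclidean space `ℂ²`; its operator norm is
`matNorm (transfer V n m z)` by definition. -/
noncomputable def transferCLM (n m : ℤ) : EuclideanSpace ℂ (Fin 2) →L[ℂ] EuclideanSpace ℂ (Fin 2) :=
  Matrix.toEuclideanCLM (𝕜 := ℂ) (transfer V n m z)

theorem transferCLM_self (n : ℤ) : transferCLM V z n n = 1 := by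
  rw [transferCLM, transfer_self, map_one]

end Transfer

section CauchyData

/-- The vector `(u(n+1), u(n))` propagated by the transfer matrices, with the Euclidean norm. -/
noncomputable def cauchyData (u : ℤ → ℂ) (n : ℤ) : EuclideanSpace ℂ (Fin 2) := !₂[u (n + 1), u n]

theorem norm_cauchyData_sq (u : ℤ → ℂ) (n : ℤ) :
    ‖cauchyData u n‖ ^ 2 = ‖u (n + 1)‖ ^ 2 + ‖u n‖ ^ 2 := by
  simp [cauchyData, EuclideanSpace.norm_sq_eq]

theorem norm_apply_succ_le_norm_cauchyData (u : ℤ → ℂ) (n : ℤ) :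
    ‖u (n + 1)‖ ≤ ‖cauchyData u n‖ :=
  PiLp.norm_apply_le (cauchyData u n) 0

theorem norm_apply_le_norm_cauchyData (u : ℤ → ℂ) (n : ℤ) : ‖u n‖ ≤ ‖cauchyData u n‖ :=
  PiLp.norm_apply_le (cauchyData u n) 1

/-- `u` satisfies the difference equation `Hu = zu` at the sites of `s`. -/
def SolvesOn (V : ℤ → ℝ) (z : ℂ) (u : ℤ → ℂ) (s : Set ℤ) : Prop :=
  ∀ k ∈ s, u (k - 1) + u (k + 1) + (V k : ℂ) * u k = z * u k

variable {V : ℤ → ℝ} {z E : ℂ} {u : ℤ → ℂ}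

theorem SolvesOn.mono {s t : Set ℤ} (hu : SolvesOn V z u t) (hst : s ⊆ t) : SolvesOn V z u s :=
  fun k hk ↦ hu k (hst hk)

theorem SolvesOn.cauchyData_eq {k : ℤ} (hu : SolvesOn V z u {k}) :
    cauchyData u k = Matrix.toEuclideanCLM (𝕜 := ℂ) (stepMatrix V E k) (cauchyData u (k - 1))
      + (z - E) • !₂[u k, 0] := by
  have hstep : u (k + 1) = u k * (E - V k) + -u (k - 1) + (z - E) * u k := by
    linear_combination hu k rfl
  ext i
  fin_cases i <;> simp [cauchyData, stepMatrix, hstep]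

theorem SolvesOn.transferCLM_cauchyData {k : ℤ} (hu : SolvesOn V z u {k}) (x : ℤ) :
    transferCLM V E x k (cauchyData u k) = transferCLM V E x (k - 1) (cauchyData u (k - 1))
      + (z - E) • transferCLM V E x k !₂[u k, 0] := by
  rw [hu.cauchyData_eq (E := E), map_add, map_smul, transferCLM, transferCLM,
    ← mul_apply_eq_comp, ← map_mul, transfer_mul_stepMatrix]

/-- Variation of parameters. The base point `x` is arbitrary: `x = n` solves for the Cauchy data at
the right end, `x = m` for those at the left end. -/
theorem SolvesOn.transferCLM_cauchyData_sub {m n : ℤ} (hmn : m ≤ n)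
    (hu : SolvesOn V z u (Set.Ioc m n)) (x : ℤ) :
    transferCLM V E x n (cauchyData u n) - transferCLM V E x m (cauchyData u m) =
      (z - E) • ∑ k ∈ Finset.Ioc m n, transferCLM V E x k !₂[u k, 0] := by
  induction n, hmn using Int.leInduction with
  | base => simp
  | succ n hmn ih =>
    have hstep := (hu.mono (Set.singleton_subset_iff.2 ⟨Int.lt_add_one_iff.2 hmn, le_rfl⟩))
      |>.transferCLM_cauchyData (E := E) x
    rw [add_sub_cancel_right] at hstep
    rw [hstep, ← Finset.insert_Ioc_right_eq_Ioc_add_one hmn, Finset.sum_insert (by simp), smul_add,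
      ← ih (hu.mono (Set.Ioc_subset_Ioc_right (Int.le_add_one le_rfl)))]
    abel

/-- `B` bounds the transfer matrices at the energy `E` between any two sites of `s`. -/
def TransferBoundOn (V : ℤ → ℝ) (E : ℂ) (B : ℝ) (s : Set ℤ) : Prop :=
  ∀ n ∈ s, ∀ m ∈ s, ‖transferCLM V E n m‖ ≤ B

theorem norm_sum_transferCLM_le {B : ℝ} {x : ℤ} {s : Finset ℤ}
    (hB : ∀ k ∈ s, ‖transferCLM V E x k‖ ≤ B) :
    ‖∑ k ∈ s, transferCLM V E x k !₂[u k, 0]‖ ≤ B * ∑ k ∈ s, ‖u k‖ := by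
  rw [Finset.mul_sum]
  refine norm_sum_le_of_le s fun k hk ↦ ?_
  have hnorm : ‖(!₂[u k, 0] : EuclideanSpace ℂ (Fin 2))‖ = ‖u k‖ := by
    simp [EuclideanSpace.norm_eq]
  exact hnorm ▸ (transferCLM V E x k).le_of_opNorm_le (hB k hk) _

variable {a b : ℤ} {B : ℝ}

theorem SolvesOn.norm_cauchyData_sub_le (hu : SolvesOn V z u (Set.Ioc a b))
    (hB : TransferBoundOn V E B (Set.Icc a b)) {x m : ℤ} (hx : x ∈ Set.Icc a b)
    (hm : m ∈ Set.Icc a b) :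
    ‖cauchyData u x - transferCLM V E x m (cauchyData u m)‖ ≤
      ‖z - E‖ * (B * ∑ k ∈ Finset.Ioc a b, ‖u k‖) := by
  have hB₀ : 0 ≤ B := (norm_nonneg _).trans (hB x hx x hx)
  have hmono {m n : ℤ} (hm : a ≤ m) (hn : n ≤ b) :
      ‖∑ k ∈ Finset.Ioc m n, transferCLM V E x k !₂[u k, 0]‖
        ≤ B * ∑ k ∈ Finset.Ioc a b, ‖u k‖ := by
    have hsub : Finset.Ioc m n ⊆ Finset.Ioc a b := Finset.Ioc_subset_Ioc hm hn
    refine (norm_sum_transferCLM_le fun k hk ↦ hB x hx k ?_).trans ?_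
    · exact Set.Ioc_subset_Icc_self (Finset.mem_Ioc.1 (hsub hk))
    · gcongr
  rcases le_total m x with hmx | hxm
  · have h := (hu.mono (Set.Ioc_subset_Ioc hm.1 hx.2)).transferCLM_cauchyData_sub (E := E) hmx x
    rw [transferCLM_self, one_apply_eq_self] at h
    rw [h, norm_smul]
    gcongr
    exact hmono hm.1 hx.2
  · have h := (hu.mono (Set.Ioc_subset_Ioc hx.1 hm.2)).transferCLM_cauchyData_sub (E := E) hxm x
    rw [transferCLM_self, one_apply_eq_self] at h
    rw [norm_sub_rev, h, norm_smul]
    gcongr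
    exact hmono hx.1 hm.2

/-- Solutions at a nearby `z` grow at most twice as fast as those at `E`: apply variation of
parameters at the site where the Cauchy data are largest and absorb the sum. -/
theorem SolvesOn.norm_cauchyData_le (hu : SolvesOn V z u (Set.Ioc a b))
    (hB : TransferBoundOn V E B (Set.Icc a b)) (hz : ‖z - E‖ * B * (b - a) ≤ 1 / 2) {n m : ℤ}
    (hn : n ∈ Set.Icc a b) (hm : m ∈ Set.Icc a b) :
    ‖cauchyData u n‖ ≤ 2 * B * ‖cauchyData u m‖ := by
  have hB₀ : 0 ≤ B := (norm_nonneg _).trans (hB n hn n hn)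
  obtain ⟨x, hx, hmax⟩ := Finset.exists_max_image (Finset.Icc a b) (fun k ↦ ‖cauchyData u k‖)
    ⟨n, Finset.mem_Icc.2 hn⟩
  have hsum : ∑ k ∈ Finset.Ioc a b, ‖u k‖ ≤ (b - a) * ‖cauchyData u x‖ := by
    have hcard : ((Finset.Ioc a b).card : ℝ) = b - a := by
      rw [Int.card_Ioc, ← Int.cast_natCast, Int.toNat_of_nonneg (sub_nonneg.2 (hn.1.trans hn.2)),
        Int.cast_sub]
    rw [← hcard, ← nsmul_eq_mul]
    exact Finset.sum_le_card_nsmul _ _ _ fun k hk ↦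
      (norm_apply_le_norm_cauchyData u k).trans (hmax k (Finset.Ioc_subset_Icc_self hk))
  have hmax_le : ‖cauchyData u x‖ ≤ B * ‖cauchyData u m‖ + 1 / 2 * ‖cauchyData u x‖ :=
    calc ‖cauchyData u x‖
        ≤ ‖transferCLM V E x m (cauchyData u m)‖
          + ‖cauchyData u x - transferCLM V E x m (cauchyData u m)‖ := norm_le_insert' _ _
      _ ≤ B * ‖cauchyData u m‖ + ‖z - E‖ * (B * ((b - a) * ‖cauchyData u x‖)) := by
          gcongr
          · exact (transferCLM V E x m).le_of_opNorm_le (hB x (Finset.mem_Icc.1 hx) m hm) _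
          · refine (hu.norm_cauchyData_sub_le hB (Finset.mem_Icc.1 hx) hm).trans ?_
            gcongr
      _ = B * ‖cauchyData u m‖ + ‖z - E‖ * B * (b - a) * ‖cauchyData u x‖ := by ring
      _ ≤ _ := by gcongr
  linarith [hmax n (Finset.mem_Icc.2 hn)]

theorem card_mul_sq_le_sum_norm_sq {i j : ℤ} (hij : i ≤ j) {c : ℝ} (hc : 0 ≤ c)
    (h : ∀ n ∈ Finset.Ico i j, c ≤ ‖cauchyData u n‖) :
    (j - i) * c ^ 2 ≤ 2 * ∑ n ∈ Finset.Icc i j, ‖u n‖ ^ 2 := by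
  have hleft : ∑ n ∈ Finset.Ico i j, ‖u n‖ ^ 2 ≤ ∑ n ∈ Finset.Icc i j, ‖u n‖ ^ 2 :=
    Finset.sum_le_sum_of_subset_of_nonneg Finset.Ico_subset_Icc_self fun _ _ _ ↦ sq_nonneg _
  have hright : ∑ n ∈ Finset.Ico i j, ‖u (n + 1)‖ ^ 2 ≤ ∑ n ∈ Finset.Icc i j, ‖u n‖ ^ 2 := by
    rw [← Finset.sum_image (f := fun n ↦ ‖u n‖ ^ 2) (add_left_injective 1).injOn]
    refine Finset.sum_le_sum_of_subset_of_nonneg ?_ fun _ _ _ ↦ sq_nonneg _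
    grind
  have hcard : ((Finset.Ico i j).card : ℝ) = j - i := by
    rw [Int.card_Ico, ← Int.cast_natCast, Int.toNat_of_nonneg (sub_nonneg.2 hij), Int.cast_sub]
  have hlower : (j - i) * c ^ 2 ≤ ∑ n ∈ Finset.Ico i j, (‖u (n + 1)‖ ^ 2 + ‖u n‖ ^ 2) := by
    rw [← hcard, ← nsmul_eq_mul]
    refine Finset.card_nsmul_le_sum _ _ _ fun n hn ↦ ?_
    rw [← norm_cauchyData_sq]
    gcongr
    exact h n hn
  rw [Finset.sum_add_distrib] at hlower
  linarith

theorem SolvesOn.mul_norm_cauchyData_sq_le (hu : SolvesOn V z u (Set.Ioc a b))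
    (hB : TransferBoundOn V E B (Set.Icc a b)) (hz : ‖z - E‖ * B * (b - a) ≤ 1 / 2) {m i j : ℤ}
    (hm : m ∈ Set.Icc a b) (hi : a ≤ i) (hij : i ≤ j) (hj : j ≤ b) :
    (j - i) * ‖cauchyData u m‖ ^ 2 ≤ 8 * B ^ 2 * ∑ n ∈ Finset.Icc i j, ‖u n‖ ^ 2 := by
  have hB₀ : 0 < B := by
    have h := hB m hm m hm
    rw [transferCLM_self, norm_one] at h
    linarith
  have hlower := card_mul_sq_le_sum_norm_sq (u := u) hij (c := ‖cauchyData u m‖ / (2 * B))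
    (by positivity) fun n hn ↦ by
      rw [Finset.mem_Ico] at hn
      rw [div_le_iff₀' (by positivity)]
      exact hu.norm_cauchyData_le hB hz hm ⟨hi.trans hn.1, hn.2.le.trans hj⟩
  calc (j - i) * ‖cauchyData u m‖ ^ 2
      = 4 * B ^ 2 * ((j - i) * (‖cauchyData u m‖ / (2 * B)) ^ 2) := by field_simp; ring
    _ ≤ 4 * B ^ 2 * (2 * ∑ n ∈ Finset.Icc i j, ‖u n‖ ^ 2) := by gcongr
    _ = _ := by ring

end CauchyData

section Shell

variable {V : ℤ → ℝ} {z E : ℂ} {u : ℤ → ℂ}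

theorem norm_source_sq_le {n : ℤ} {c : ℂ}
    (h : u (n - 1) + u (n + 1) + (V n : ℂ) * u n = z * u n + c) :
    ‖c‖ ^ 2 ≤ 2 * (1 + ‖V n - z‖) ^ 2 * (‖u (n - 1)‖ ^ 2 + ‖cauchyData u n‖ ^ 2) := by
  have hc : c = u (n - 1) + u (n + 1) + (V n - z) * u n := by linear_combination -h
  have hnorm : ‖c‖ ≤ ‖u (n - 1)‖ + (1 + ‖V n - z‖) * ‖cauchyData u n‖ :=
    calc ‖c‖ ≤ ‖u (n - 1)‖ + ‖u (n + 1)‖ + ‖V n - z‖ * ‖u n‖ := by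
          rw [hc, ← norm_mul]
          exact norm_add₃_le
      _ ≤ ‖u (n - 1)‖ + ‖cauchyData u n‖ + ‖V n - z‖ * ‖cauchyData u n‖ := by
          gcongr
          · exact norm_apply_succ_le_norm_cauchyData u n
          · exact norm_apply_le_norm_cauchyData u n
      _ = _ := by ring
  have hL : 1 ≤ (1 + ‖V n - z‖) ^ 2 := one_le_pow₀ (le_add_of_nonneg_right (norm_nonneg _))
  calc ‖c‖ ^ 2 ≤ (‖u (n - 1)‖ + (1 + ‖V n - z‖) * ‖cauchyData u n‖) ^ 2 := by gcongr
    _ ≤ 2 * (‖u (n - 1)‖ ^ 2 + ((1 + ‖V n - z‖) * ‖cauchyData u n‖) ^ 2) := add_sq_le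
    _ ≤ _ := by nlinarith [sq_nonneg ‖u (n - 1)‖]

/-- The sites with `M ≤ |n| ≤ 2M`. -/
noncomputable def dyadicShell (M : ℤ) : Finset ℤ :=
  Finset.Icc (-(2 * M)) (-M) ∪ Finset.Icc M (2 * M)

theorem sum_dyadicShell {M : ℤ} (hM : 1 ≤ M) (f : ℤ → ℝ) :
    ∑ n ∈ dyadicShell M, f n =
      ∑ n ∈ Finset.Icc (-(2 * M)) (-M), f n + ∑ n ∈ Finset.Icc M (2 * M), f n :=
  Finset.sum_union <| Finset.disjoint_left.2 fun n hn hn' ↦ by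
    rw [Finset.mem_Icc] at hn hn'
    lia

theorem abs_mem_Icc_of_mem_dyadicShell {M n : ℤ} (hn : n ∈ dyadicShell M) :
    |n| ∈ Set.Icc M (2 * M) := by
  simp only [dyadicShell, Finset.mem_union, Finset.mem_Icc] at hn
  rw [Set.mem_Icc]
  grind

theorem mul_le_sum_dyadicShell {M : ℤ} (hM : 1 ≤ M) {B : ℝ} (hz : ‖z - E‖ * B * (2 * M) ≤ 1 / 2)
    (hu : SolvesOn V z u (Set.Ioc 1 (2 * M))) (hB : TransferBoundOn V E B (Set.Icc 1 (2 * M)))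
    (hleft : u 0 = 0 ∨ SolvesOn V z u (Set.Ioc (-(2 * M)) 0) ∧
      TransferBoundOn V E B (Set.Icc (-(2 * M)) 0)) :
    M * (‖u 0‖ ^ 2 + ‖cauchyData u 1‖ ^ 2) ≤ 8 * B ^ 2 * ∑ n ∈ dyadicShell M, ‖u n‖ ^ 2 := by
  have hright : M * ‖cauchyData u 1‖ ^ 2 ≤ 8 * B ^ 2 * ∑ n ∈ Finset.Icc M (2 * M), ‖u n‖ ^ 2 := by
    have h1 : (1 : ℤ) ∈ Set.Icc 1 (2 * M) := ⟨le_rfl, by lia⟩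
    have hB₀ : 0 ≤ B := (norm_nonneg _).trans (hB 1 h1 1 h1)
    have hz' : ‖z - E‖ * B * ((2 * M : ℤ) - (1 : ℤ)) ≤ 1 / 2 := by
      refine le_trans ?_ hz
      gcongr
      simp
    convert hu.mul_norm_cauchyData_sq_le hB hz' h1 hM (show M ≤ 2 * M by lia) le_rfl using 2
    push_cast
    ring
  have hleft' : M * ‖u 0‖ ^ 2 ≤ 8 * B ^ 2 * ∑ n ∈ Finset.Icc (-(2 * M)) (-M), ‖u n‖ ^ 2 := by
    rcases hleft with h0 | ⟨hu', hB'⟩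
    · rw [h0, norm_zero, zero_pow two_ne_zero, mul_zero]
      positivity
    · have hz' : ‖z - E‖ * B * ((0 : ℤ) - (-(2 * M) : ℤ)) ≤ 1 / 2 := by
        simpa using hz
      refine le_trans ?_ (hu'.mul_norm_cauchyData_sq_le hB' hz' (m := 0) (j := -M)
        ⟨by lia, le_rfl⟩ le_rfl (by lia) (by lia))
      have hM₀ : (0 : ℝ) ≤ M := by exact_mod_cast zero_le_one.trans hM
      push_cast
      rw [show -(M : ℝ) - -(2 * M) = M by ring]
      have hnorm : ‖u 0‖ ^ 2 ≤ ‖cauchyData u 0‖ ^ 2 := by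
        gcongr
        exact norm_apply_le_norm_cauchyData u 0
      exact mul_le_mul_of_nonneg_left hnorm hM₀
  rw [sum_dyadicShell hM, mul_add, mul_add]
  linarith

/-- The power law assumed of the transfer matrices, restricted to the sites of `s`. -/
def PowerBoundedOn (V : ℤ → ℝ) (E : ℂ) (α C : ℝ) (s : Set ℤ) : Prop :=
  ∀ n ∈ s, ∀ m ∈ s, (n ≠ 0 ∨ m ≠ 0) →
    matNorm (transfer V n m E) ≤ C * (|(n : ℝ)| + |(m : ℝ)|) ^ α

theorem PowerBoundedOn.mono {α C : ℝ} {s t : Set ℤ} (h : PowerBoundedOn V E α C t) (hst : s ⊆ t) :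
    PowerBoundedOn V E α C s :=
  fun n hn m hm ↦ h n (hst hn) m (hst hm)

theorem PowerBoundedOn.transferBoundOn {α C : ℝ} (hα : 0 ≤ α) {s t : Set ℤ}
    (h : PowerBoundedOn V E α C s) {M : ℤ} (hM : 1 ≤ M) (hst : t ⊆ s)
    (ht : ∀ n ∈ t, |n| ≤ 2 * M) : TransferBoundOn V E (max C 1 * (4 * M) ^ α) t := by
  intro n hn m hm
  have hM' : (1 : ℝ) ≤ M := by exact_mod_cast hM
  by_cases h0 : n ≠ 0 ∨ m ≠ 0
  · have hsum : |(n : ℝ)| + |(m : ℝ)| ≤ 4 * M := by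
      exact_mod_cast (by linarith [ht n hn, ht m hm] : |n| + |m| ≤ 4 * M)
    refine (h n (hst hn) m (hst hm) h0).trans ?_
    gcongr
    exact le_max_left C 1
  · push Not at h0
    rw [h0.1, h0.2, transferCLM_self, norm_one]
    exact one_le_mul_of_one_le_of_one_le (le_max_right C 1)
      (Real.one_le_rpow (by linarith) hα)

end Shell

section Evolution

variable {S : Set ℤ} {V : ℤ → ℝ} {w : ℂ}

theorem zeroExt_delta₁ {n : ℤ} (hn : n ∈ S) : zeroExt S (delta₁ S) n = if n = 1 then 1 else 0 := by
  lift n to S using hn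
  rw [zeroExt_coe, delta₁]

theorem solvesOn_laplace_evolution (hw : 0 < w.re) :
    SolvesOn V (Complex.I * w) (zeroExt S (laplace (evolution S V) w : L2 S)) (S \ {1}) := by
  rintro n ⟨hn, hn₁ : n ≠ 1⟩
  have h := zeroExt_laplace_eq (evolution_spec S V) hw hn
  rwa [actionCLM_apply, zeroExt_delta₁ hn, if_neg hn₁, mul_zero, sub_zero] at h

theorem one_le_laplace_evolution (h1 : 1 ∈ S) (hw : 0 < w.re) :
    1 ≤ 2 * (1 + ‖V 1 - Complex.I * w‖) ^ 2 *
      (‖zeroExt S (laplace (evolution S V) w : L2 S) 0‖ ^ 2 +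
        ‖cauchyData (zeroExt S (laplace (evolution S V) w : L2 S)) 1‖ ^ 2) := by
  have h := zeroExt_laplace_eq (evolution_spec S V) hw h1
  rw [actionCLM_apply, zeroExt_delta₁ h1, if_pos rfl, mul_one] at h
  simpa using norm_source_sq_le (h.trans (sub_eq_add_neg _ _))

theorem le_sum_dyadicShell_laplace (hS : Set.Ici 1 ⊆ S) (hS₀ : 0 ∈ S → Set.Iic 0 ⊆ S)
    (hw : 0 < w.re) {E : ℂ} {B : ℝ} {M : ℤ} (hM : 1 ≤ M)
    (hz : ‖Complex.I * w - E‖ * B * (2 * M) ≤ 1 / 2)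
    (hB : TransferBoundOn V E B (Set.Icc 1 (2 * M)))
    (hB₀ : 0 ∈ S → TransferBoundOn V E B (Set.Icc (-(2 * M)) 0)) :
    M ≤ 16 * (1 + ‖V 1 - Complex.I * w‖) ^ 2 * B ^ 2 *
      ∑ n ∈ dyadicShell M, ‖zeroExt S (laplace (evolution S V) w : L2 S) n‖ ^ 2 := by
  set u := zeroExt S (laplace (evolution S V) w : L2 S)
  have hsolves : SolvesOn V (Complex.I * w) u (S \ {1}) := solvesOn_laplace_evolution hw
  have hright : SolvesOn V (Complex.I * w) u (Set.Ioc 1 (2 * M)) :=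
    hsolves.mono fun k hk ↦ ⟨hS hk.1.le, hk.1.ne'⟩
  have hleft : u 0 = 0 ∨ SolvesOn V (Complex.I * w) u (Set.Ioc (-(2 * M)) 0) ∧
      TransferBoundOn V E B (Set.Icc (-(2 * M)) 0) := by
    by_cases h0 : 0 ∈ S
    · exact .inr ⟨hsolves.mono fun k hk ↦ ⟨hS₀ h0 hk.2, (hk.2.trans_lt zero_lt_one).ne⟩, hB₀ h0⟩
    · exact .inl (zeroExt_of_notMem S _ h0)
  have hM₀ : (0 : ℝ) ≤ M := by exact_mod_cast zero_le_one.trans hM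
  calc (M : ℝ) = M * 1 := (mul_one _).symm
    _ ≤ M * (2 * (1 + ‖V 1 - Complex.I * w‖) ^ 2 * (‖u 0‖ ^ 2 + ‖cauchyData u 1‖ ^ 2)) := by
        exact mul_le_mul_of_nonneg_left (one_le_laplace_evolution (hS Set.self_mem_Ici) hw) hM₀
    _ = 2 * (1 + ‖V 1 - Complex.I * w‖) ^ 2 * (M * (‖u 0‖ ^ 2 + ‖cauchyData u 1‖ ^ 2)) := by ring
    _ ≤ 2 * (1 + ‖V 1 - Complex.I * w‖) ^ 2 * (8 * B ^ 2 * ∑ n ∈ dyadicShell M, ‖u n‖ ^ 2) := by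
        exact mul_le_mul_of_nonneg_left (mul_le_sum_dyadicShell hM hz hright hB hleft)
          (by positivity)
    _ = _ := by ring

/-- The Laplace parameter `2/T - iE`. Multiplication by `i` turns it into the spectral parameter
`E + 2i/T`, and its real part is the rate in the weight `e^{-2t/T}` of the time averages. -/
noncomputable def laplaceParam (E T : ℝ) : ℂ :=
  2 / T - Complex.I * E

variable {E T : ℝ}

theorem laplaceParam_re (E T : ℝ) : (laplaceParam E T).re = 2 / T := by
  simp [laplaceParam, ← Complex.ofReal_ofNat, ← Complex.ofReal_div]

theorem norm_I_mul_laplaceParam_sub (E : ℝ) (hT : 0 < T) :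
    ‖Complex.I * laplaceParam E T - E‖ = 2 / T := by
  have h : Complex.I * laplaceParam E T - E = Complex.I * (2 / T : ℝ) := by
    rw [laplaceParam]
    push_cast
    linear_combination -(E : ℂ) * Complex.I_sq
  rw [h, norm_mul, Complex.norm_I, one_mul, Complex.norm_of_nonneg (by positivity)]

theorem norm_sub_I_mul_laplaceParam_le (v E : ℝ) (hT : 1 ≤ T) :
    ‖v - Complex.I * laplaceParam E T‖ ≤ |v - E| + 2 := by
  rw [← sub_sub_sub_cancel_right _ _ (E : ℂ)]
  refine (norm_sub_le _ _).trans (add_le_add ?_ ?_)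
  · rw [← Complex.ofReal_sub, Complex.norm_real, Real.norm_eq_abs]
  · rw [norm_I_mul_laplaceParam_sub E (by linarith)]
    exact div_le_self zero_le_two hT

theorem le_sum_dyadicShell_laplaceParam (hS : Set.Ici 1 ⊆ S) (hS₀ : 0 ∈ S → Set.Iic 0 ⊆ S)
    (hT : 1 ≤ T) {B : ℝ} {M : ℤ} (hM : 1 ≤ M) (hBT : 8 * B * M ≤ T)
    (hB : TransferBoundOn V E B (Set.Icc 1 (2 * M)))
    (hB₀ : 0 ∈ S → TransferBoundOn V E B (Set.Icc (-(2 * M)) 0)) :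
    M ≤ 16 * (3 + |V 1 - E|) ^ 2 * B ^ 2 * ∑ n ∈ dyadicShell M,
      ‖zeroExt S (laplace (evolution S V) (laplaceParam E T) : L2 S) n‖ ^ 2 := by
  have hT₀ : 0 < T := by linarith
  have hre : 0 < (laplaceParam E T).re := laplaceParam_re E T ▸ by positivity
  have hz : ‖Complex.I * laplaceParam E T - E‖ * B * (2 * M) ≤ 1 / 2 := by
    rw [norm_I_mul_laplaceParam_sub E hT₀, show 2 / T * B * (2 * M) = 8 * B * M / T / 2 by ring]
    gcongr
    exact (div_le_one hT₀).2 hBT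
  have hV : 1 + ‖V 1 - Complex.I * laplaceParam E T‖ ≤ 3 + |V 1 - E| := by
    linarith [norm_sub_I_mul_laplaceParam_le (V 1) E hT]
  refine (le_sum_dyadicShell_laplace hS hS₀ hre hM hz hB hB₀).trans ?_
  gcongr ?_ * ?_ ^ 2 * ?_ * ?_

theorem two_rpow_neg_abs_mul_rpow_le {x y : ℝ} (hx : 0 < x) (hxy : x ≤ 2 * y) (hyx : y ≤ 2 * x)
    (q : ℝ) : 2 ^ (-|q|) * x ^ q ≤ y ^ q := by
  have hy : 0 < y := by linarith
  rcases le_total 0 q with hq | hq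
  · rw [abs_of_nonneg hq, Real.rpow_neg zero_le_two, inv_mul_le_iff₀ (by positivity),
      ← Real.mul_rpow zero_le_two hy.le]
    gcongr
  · rw [abs_of_nonpos hq, neg_neg, ← Real.mul_rpow zero_le_two hx.le]
    exact Real.rpow_le_rpow_of_nonpos hy hyx hq

theorem ofReal_sum_dyadicShell_laplace_le_moment (S : Set ℤ) (V : ℤ → ℝ) (E : ℝ) (hT : 0 < T)
    {M : ℤ} (hM : 1 ≤ M) (p : ℝ) :
    ENNReal.ofReal (2 ^ (-|p|) * (M : ℝ) ^ p * (2 / T ^ 2) * ∑ n ∈ dyadicShell M,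
      ‖zeroExt S (laplace (evolution S V) (laplaceParam E T) : L2 S) n‖ ^ 2) ≤
        moment S V p T := by
  have hM₀ : (0 : ℝ) < M := by exact_mod_cast zero_lt_one.trans_le hM
  refine ofReal_sum_laplace_le_moment S V hT (laplaceParam_re E T) (by positivity) fun n hn ↦ ?_
  obtain ⟨hlo, hhi⟩ := abs_mem_Icc_of_mem_dyadicShell hn
  refine two_rpow_neg_abs_mul_rpow_le hM₀ ?_ ?_ p
  · exact_mod_cast (by lia : M ≤ 2 * |n|)
  · exact_mod_cast hhi

theorem ofReal_rpow_le_moment (hS : Set.Ici 1 ⊆ S) (hS₀ : 0 ∈ S → Set.Iic 0 ⊆ S) (hT : 1 ≤ T)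
    {B : ℝ} (hB_pos : 0 < B) {M : ℤ} (hM : 1 ≤ M) (hBT : 8 * B * M ≤ T)
    (hB : TransferBoundOn V E B (Set.Icc 1 (2 * M)))
    (hB₀ : 0 ∈ S → TransferBoundOn V E B (Set.Icc (-(2 * M)) 0)) (p : ℝ) :
    ENNReal.ofReal (2 ^ (-|p|) * (M : ℝ) ^ (p + 1) / (8 * (3 + |V 1 - E|) ^ 2 * B ^ 2 * T ^ 2)) ≤
      moment S V p T := by
  have hM₀ : (0 : ℝ) < M := by exact_mod_cast zero_lt_one.trans_le hM
  have hsum := le_sum_dyadicShell_laplaceParam hS hS₀ hT hM hBT hB hB₀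
  refine (ENNReal.ofReal_le_ofReal ?_).trans
    (ofReal_sum_dyadicShell_laplace_le_moment S V E (by linarith) hM p)
  calc 2 ^ (-|p|) * (M : ℝ) ^ (p + 1) / (8 * (3 + |V 1 - E|) ^ 2 * B ^ 2 * T ^ 2)
      = 2 ^ (-|p|) * (M : ℝ) ^ p * (2 / T ^ 2) * (M / (16 * (3 + |V 1 - E|) ^ 2 * B ^ 2)) := by
        rw [Real.rpow_add hM₀, Real.rpow_one]
        field_simp
        norm_num
    _ ≤ _ := by
        gcongr
        exact (div_le_iff₀' (by positivity)).2 hsum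

theorem exists_rpow_le_moment (hS : Set.Ici 1 ⊆ S) (hS₀ : 0 ∈ S → Set.Iic 0 ⊆ S) {α C : ℝ}
    (hα : 0 ≤ α) (hpos : PowerBoundedOn V E α C (Set.Ici 1))
    (hneg : 0 ∈ S → PowerBoundedOn V E α C (Set.Iic 0)) (p : ℝ) :
    ∃ c > 0, ∃ D > 0, ∀ T : ℝ, 1 ≤ T → ∀ M : ℤ, 1 ≤ M → D * (M : ℝ) ^ (1 + α) ≤ T →
      ENNReal.ofReal (c * (M : ℝ) ^ (p + 1 - 2 * α) / T ^ 2) ≤ moment S V p T := by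
  set K : ℝ := max C 1 * 4 ^ α with hK
  have hK₀ : 0 < K := by positivity
  refine ⟨2 ^ (-|p|) / (8 * (3 + |V 1 - E|) ^ 2 * K ^ 2), by positivity, 8 * K, by positivity, ?_⟩
  intro T hT M hM hMT
  have hM₀ : (0 : ℝ) < M := by exact_mod_cast zero_lt_one.trans_le hM
  have hKM : max C 1 * (4 * M) ^ α = K * (M : ℝ) ^ α := by
    rw [Real.mul_rpow zero_le_four hM₀.le, hK, mul_assoc]
  have hBpos := hpos.transferBoundOn hα hM (t := Set.Icc 1 (2 * M)) (fun n hn ↦ hn.1)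
    fun n hn ↦ abs_le.2 ⟨by linarith [hn.1], hn.2⟩
  have hBneg (h0 : 0 ∈ S) := (hneg h0).transferBoundOn hα hM (t := Set.Icc (-(2 * M)) 0)
    (fun n hn ↦ hn.2) fun n hn ↦ abs_le.2 ⟨hn.1, by linarith [hn.2]⟩
  rw [hKM] at hBpos hBneg
  have hscale : 8 * (K * (M : ℝ) ^ α) * M ≤ T :=
    le_of_eq_of_le (by rw [Real.rpow_add hM₀, Real.rpow_one]; ring) hMT
  convert ofReal_rpow_le_moment hS hS₀ hT (by positivity) hM hscale hBpos hBneg p using 2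
  rw [Real.rpow_sub hM₀, mul_comm 2 α, Real.rpow_mul hM₀.le, Real.rpow_two]
  field_simp

end Evolution

section GrowthExponent

/-- The exponent comes from the largest admissible scale `M = ⌊(T / D) ^ s⁻¹⌋`. -/
theorem exists_eventually_rpow_le {f : ℝ → ENNReal} {c D s q : ℝ} (hc : 0 < c) (hD : 0 < D)
    (hs : 0 < s)
    (hf : ∀ T : ℝ, 1 ≤ T → ∀ M : ℤ, 1 ≤ M → D * (M : ℝ) ^ s ≤ T →
      ENNReal.ofReal (c * (M : ℝ) ^ q / T ^ 2) ≤ f T) :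
    ∃ k > 0, ∀ᶠ T : ℝ in atTop, ENNReal.ofReal (k * T ^ (q / s - 2)) ≤ f T := by
  refine ⟨c * 2 ^ (-|q|) / D ^ (q / s), by positivity, ?_⟩
  filter_upwards [eventually_ge_atTop 1, eventually_ge_atTop D] with T hT hDT
  have hT₀ : 0 < T := by linarith
  set x := (T / D) ^ s⁻¹ with hx
  have hx₁ : 1 ≤ x := Real.one_le_rpow ((one_le_div hD).2 hDT) (by positivity)
  have hM : 1 ≤ ⌊x⌋ := Int.le_floor.2 (by exact_mod_cast hx₁)
  have hM' : (1 : ℝ) ≤ ⌊x⌋ := by exact_mod_cast hM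
  have hscale : D * (⌊x⌋ : ℝ) ^ s ≤ T :=
    calc D * (⌊x⌋ : ℝ) ^ s ≤ D * x ^ s := by
          gcongr
          exact Int.floor_le x
      _ = T := by rw [hx, Real.rpow_inv_rpow (by positivity) hs.ne', mul_div_cancel₀ _ hD.ne']
  have hxq : x ^ q = T ^ (q / s) / D ^ (q / s) := by
    rw [hx, ← Real.rpow_mul (by positivity), inv_mul_eq_div, Real.div_rpow hT₀.le hD.le]
  refine (ENNReal.ofReal_le_ofReal ?_).trans (hf T hT ⌊x⌋ hM hscale)
  calc c * 2 ^ (-|q|) / D ^ (q / s) * T ^ (q / s - 2)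
      = c * (2 ^ (-|q|) * x ^ q) / T ^ 2 := by
        rw [hxq, Real.rpow_sub hT₀, Real.rpow_two]
        ring
    _ ≤ c * (⌊x⌋ : ℝ) ^ q / T ^ 2 := by
        gcongr
        exact two_rpow_neg_abs_mul_rpow_le (by linarith) (by linarith [Int.lt_floor_add_one x])
          (by linarith [Int.floor_le x]) q

theorem le_liminf_log_div_log {f : ℝ → ENNReal} {k γ : ℝ} (hk : 0 < k)
    (h : ∀ᶠ T : ℝ in atTop, ENNReal.ofReal (k * T ^ γ) ≤ f T) :
    (γ : EReal) ≤ liminf (fun T : ℝ ↦ ENNReal.log (f T) / ((Real.log T : ℝ) : EReal)) atTop := by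
  have hlim : Tendsto (fun T : ℝ ↦ ((γ + Real.log k / Real.log T : ℝ) : EReal)) atTop
      (𝓝 (γ : EReal)) := by
    refine (continuous_coe_real_ereal.tendsto γ).comp ?_
    simpa using (tendsto_const_nhds (x := γ)).add
      (tendsto_const_nhds.div_atTop (a := Real.log k) Real.tendsto_log_atTop)
  rw [← hlim.liminf_eq]
  refine liminf_le_liminf ?_
  filter_upwards [h, eventually_gt_atTop 1] with T hfT hT
  have hT₀ : 0 < T := by linarith
  have hlog : 0 < Real.log T := Real.log_pos hT
  have hquot : γ + Real.log k / Real.log T = Real.log (k * T ^ γ) / Real.log T := by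
    rw [Real.log_mul hk.ne' (by positivity), Real.log_rpow hT₀]
    field_simp
    ring
  rw [hquot, EReal.coe_div]
  refine EReal.div_le_div_right_of_nonneg (by exact_mod_cast hlog.le) ?_
  rw [← ENNReal.log_ofReal_of_pos (by positivity)]
  exact ENNReal.log_monotone hfT

end GrowthExponent

end OneEnergy

theorem corollary1_general {S : Set ℤ} (hS : Set.Ici 1 ⊆ S) (hS₀ : 0 ∈ S → Set.Iic 0 ⊆ S)
    {V : ℤ → ℝ} {E₀ α C : ℝ} (hα : 0 ≤ α)
    (hpos : OneEnergy.PowerBoundedOn V E₀ α C (Set.Ici 1))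
    (hneg : 0 ∈ S → OneEnergy.PowerBoundedOn V E₀ α C (Set.Iic 0)) (p : ℝ) :
    (((p - 1 - 4 * α) / (1 + α) : ℝ) : EReal) ≤ OneEnergy.betaMinus S V p := by
  have hs : 0 < 1 + α := by positivity
  obtain ⟨c, hc, D, hD, hmoment⟩ := OneEnergy.exists_rpow_le_moment hS hS₀ hα hpos hneg p
  obtain ⟨k, hk, hgrowth⟩ := OneEnergy.exists_eventually_rpow_le hc hD hs hmoment
  have hexp : (p - 1 - 4 * α) / (1 + α) = (p + 1 - 2 * α) / (1 + α) - 2 := by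
    field_simp
    ring
  rw [hexp]
  exact OneEnergy.le_liminf_log_div_log hk hgrowth

theorem corollary1 (S : Set ℤ) (hS : S = Set.univ ∨ S = Set.Ici 1) (V : ℤ → ℝ)
    (E₀ α C : ℝ) (hα : 0 ≤ α)
    (hT : ∀ n ∈ S, ∀ m ∈ S, (n ≠ 0 ∨ m ≠ 0) →
      OneEnergy.matNorm (OneEnergy.transfer V n m (E₀ : ℂ)) ≤ C * (|(n : ℝ)| + |(m : ℝ)|) ^ α)
    (p : ℝ) (hp : 0 < p) :
    (((p - 1 - 4 * α) / (1 + α) : ℝ) : EReal) ≤ OneEnergy.betaMinus S V p := by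
  have hright : Set.Ici 1 ⊆ S := by rcases hS with rfl | rfl <;> simp
  have hleft : 0 ∈ S → Set.Iic 0 ⊆ S := by rcases hS with rfl | rfl <;> simp
  have hbdd : OneEnergy.PowerBoundedOn V E₀ α C S := hT
  exact corollary1_general hright hleft hα (hbdd.mono hright) (fun h0 ↦ hbdd.mono (hleft h0)) p
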